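/- Let $k$ be a field, let $n\ge 1$, let $R=k[x_1,\dots,x_{3n+2}]$, and let $I=(x_1x_2,\,x_2x_3,\,\dots,\,x_{3n+1}x_{3n+2},\,x_{3n+2}x_1)$ be the edge ideal of the cycle $C_{3n+2}$ on $3n+2$ vertices. Put $$f_1=x_1+x_{3n+2}+x_2,\qquad f_i=x_{3i-2}+x_{3i-3}+x_{3i-1}\ \ (2\le i\le n),\qquad f_{n+1}=x_{3n}+x_{3n+1}+\sum_{i=1}^{n}x_{3i-1}.$$ For a term order $>$ on $R$ and a proper ideal $J\subset R$, nonconstant polynomials $g_1,\dots,g_q\in R$ are called an initially regular sequence on $R/J$ with respect to $>$ if, with $J_1=\operatorname{in}_>(J)$ and $J_i=\operatorname{in}_>\big(J_{i-1}+(g_{i-1})\big)$ for $2\le i\le q$, the polynomial $g_i$ is a nonzerodivisor on $R/J_i$ for every $1\le i\le q$. There exist term orders on $R$ satisfying $$x_1>x_{3n+2}>x_2\quad\text{and}\quad x_{3i-2}>x_{3i-3}>x_{3i-1}\ \text{ for all } 2\le i\le n,$$ and with respect to every such term order $f_1,\dots,f_{n+1}$ is an initially regular sequence on $R/I$. Its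 length realizes the depth of $R/I$: $\operatorname{depth}(R/I)=n+1$, where the depth is the supremum of the lengths of the $R/I$-regular sequences consisting of elements of $(x_1,\dots,x_{3n+2})$. -/

import Mathlib

open MvPolynomial
open scoped MonomialOrder

noncomputable section

namespace InitReg

/-- The edge ideal of a graph `G`: generated by the products `x_u x_v` over the edges `{u, v}`. -/
def edgeIdeal {V : Type*} (k : Type*) [Field k] (G : SimpleGraph V) : Ideal (MvPolynomial V k) :=
  Ideal.span {p | ∃ u v : V, G.Adj u v ∧ p = X u * X v}

/-- The initial ideal of `I`: generated by the leading terms of all elements of `I`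
(the leading term of `0` being `0`). -/
def initialIdeal {σ k : Type*} [Field k] (m : MonomialOrder σ) (I : Ideal (MvPolynomial σ k)) :
    Ideal (MvPolynomial σ k) :=
  Ideal.span (m.leadingTerm '' (I : Set (MvPolynomial σ k)))

/-- For a sequence `f 1, f 2, …`, the ideal obtained after using `f 1, …, f i`:
it is `in(I)` for `i = 0`, and `in(J, f (i + 1))` at `i + 1`, where `J` is the ideal at `i`. -/
def stageIdeal {σ k : Type*} [Field k] (m : MonomialOrder σ) (I : Ideal (MvPolynomial σ k))
    (f : ℕ → MvPolynomial σ k) : ℕ → Ideal (MvPolynomial σ k)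
  | 0 => initialIdeal m I
  | i + 1 => initialIdeal m (stageIdeal m I f i ⊔ Ideal.span {f (i + 1)})

/-- The finite sequence `f 1, …, f q` (length `q`; other values of `f` play no role) is an
initially regular sequence on `R / I` with respect to the term order `m`: `I` is proper, every
`f i` is nonconstant, and `f (i + 1)` is a nonzerodivisor on `R` modulo the ideal obtained
after using `f 1, …, f i`. -/
structure IsInitiallyRegular {σ k : Type*} [Field k] (m : MonomialOrder σ)
    (I : Ideal (MvPolynomial σ k)) (f : ℕ → MvPolynomial σ k) (q : ℕ) : Prop where
  ne_top : I ≠ ⊤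
  nonconstant : ∀ i < q, f (i + 1) ∉ Set.range (C : k → MvPolynomial σ k)
  regular : ∀ i < q, IsSMulRegular (MvPolynomial σ k ⧸ stageIdeal m I f i) (f (i + 1))

/-- The depth of `M` with respect to the ideal `J`: the supremum of the lengths of the
`M`-regular sequences with all terms in `J`. -/
def depth {R : Type*} [CommRing R] (J : Ideal R) (M : Type*) [AddCommGroup M] [Module R M] : ℕ∞ :=
  ⨆ rs ∈ {rs : List R | (∀ r ∈ rs, r ∈ J) ∧ RingTheory.Sequence.IsRegular M rs},
    (rs.length : ℕ∞)

/-- The vertex with label `j`, `1 ≤ j ≤ 3n+2`; `Fin (3n+2)` counts from `0`. -/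
def vtx (n j : ℕ) : Fin (3 * n + 2) := Fin.ofNat (3 * n + 2) (j - 1)

/-- The variable `x_j`, `1 ≤ j ≤ 3n+2`. -/
def x (k : Type*) [Field k] (n j : ℕ) : MvPolynomial (Fin (3 * n + 2)) k := X (vtx n j)

/-- The linear forms `f_1, …, f_{n+1}`. -/
def cycleForm (k : Type*) [Field k] (n i : ℕ) : MvPolynomial (Fin (3 * n + 2)) k :=
  if i = 1 then x k n 1 + x k n (3 * n + 2) + x k n 2
  else if i ≤ n then x k n (3 * i - 2) + x k n (3 * i - 3) + x k n (3 * i - 1)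
  else x k n (3 * n) + x k n (3 * n + 1) + ∑ j ∈ Finset.Icc 1 n, x k n (3 * j - 1)

/-- In the term order `m`, the variable `x_i` is larger than the variable `x_j`. -/
def VarGT {n : ℕ} (m : MonomialOrder (Fin (3 * n + 2))) (i j : ℕ) : Prop :=
  Finsupp.single (vtx n j) 1 ≺[m] Finsupp.single (vtx n i) 1

/-- The requirements on the term order: `x_1 > x_{3n+2} > x_2`, and
`x_{3i-2} > x_{3i-3} > x_{3i-1}` for `2 ≤ i ≤ n`. -/
structure IsAdmissible {n : ℕ} (m : MonomialOrder (Fin (3 * n + 2))) : Prop where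
  first : VarGT m 1 (3 * n + 2) ∧ VarGT m (3 * n + 2) 2
  later : ∀ i, 2 ≤ i → i ≤ n →
    VarGT m (3 * i - 2) (3 * i - 3) ∧ VarGT m (3 * i - 3) (3 * i - 1)

end InitReg

end

/-!
# An initially regular sequence realizing the depth of the edge ideal of `C_{3n+2}`

Cut the cycle into `n` triples `left j - center j - right j` and two remaining consecutive vertices.
For `i ≤ n` the form `f_i` is the sum of the variables of a triple, and the term order makes the
centre largest and `right` smallest.

*Initial regularity.* All ideals `J_i` are monomial, and modulo a monomial ideal a sum of variables
is a nonzerodivisor as soon as no monomial outside the ideal is multiplied into it by all these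
variables (`isSMulRegular_sum_X`). The ideals are computed one triple at a time
(`initialIdeal_collapse`): if `c, a, b` is a triple with outer neighbours `a'` of `a` and `b'` of
`b`, adding `c + a + b` replaces the generators `ca`, `cb` by `c`, `a²`, `ab`, `b² a'` and keeps all
others. That these monomials lie in the initial ideal is seen from the elements `a² + ab` and
`ab + b²`. Conversely, for a monomial `u` outside the claimed ideal there is a linear functional
that vanishes on the ideal and on all monomials smaller than `u` but not at `u`, so `u` is
not a leading monomial (`degree_mem_of_collapse`). For the last form, a monomial annihilated by
all its variables would be divisible by `right (n - 1)`, hence successively by all `right j`, and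
also by `left 0`, but `left 0 * right 0` is in the ideal (`exists_mem_lastVars`).

*Depth.* For the lower bound, Rees' theorem turns depth into the vanishing of `Ext`, which passes to
the middle term of `0 → R/(I : x) → R/I → R/(I + (x)) → 0`. For an edge ideal and a vertex `x`, the
outer terms belong to the graphs where the neighbours of `x`, respectively `x` itself, are removed;
splitting off vertices along the cycle leads to sets of isolated vertices (`extVanish_path`). For
the upper bound, each element of a regular sequence in a prime `𝔪` moves an associated prime
contained in `𝔪` to a strictly larger one, so the depth is at most `dim R/P` for every associated
prime `P` contained in `𝔪`; the vertices `0, 3, …, 3n` (counted from `0`) form an independent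
dominating set, whose complement generates such a prime.
-/

open MvPolynomial
open scoped MonomialOrder

noncomputable section

namespace InitReg

/-! ### Monomial ideals and their initial ideals -/

variable {σ : Type*} {k : Type*} [Field k]

/-- The ideal generated by the monomials with exponent in `U`. -/
def monomialIdeal (k : Type*) [Field k] (U : Set (σ →₀ ℕ)) : Ideal (MvPolynomial σ k) :=
  Ideal.span ((fun s => monomial s (1 : k)) '' U)

lemma mem_monomialIdeal {U : Set (σ →₀ ℕ)} (hU : IsUpperSet U) {p : MvPolynomial σ k} :
    p ∈ monomialIdeal k U ↔ ∀ t ∈ p.support, t ∈ U := by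
  rw [monomialIdeal, mem_ideal_span_monomial_image]
  exact forall₂_congr fun t _ => ⟨fun ⟨s, hs, hst⟩ => hU hst hs, fun h => ⟨t, h, le_rfl⟩⟩

lemma monomial_mem_monomialIdeal {U : Set (σ →₀ ℕ)} {t : σ →₀ ℕ} (ht : t ∈ U) (c : k) :
    monomial t c ∈ monomialIdeal k U := by
  have : monomial t c = C c * monomial t 1 := by simp [C_mul_monomial]
  rw [this]
  exact Ideal.mul_mem_left _ _ (Ideal.subset_span ⟨t, ht, rfl⟩)

/-- Over a field, an initial ideal is determined by the exponents of the leading terms: they have to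
lie in `U`, and every element of `U` has to be a multiple of one of them. -/
lemma initialIdeal_eq_monomialIdeal (m : MonomialOrder σ) {K : Ideal (MvPolynomial σ k)}
    {U : Set (σ →₀ ℕ)} (hK : ∀ g ∈ K, g ≠ 0 → m.degree g ∈ U)
    (hU : ∀ u ∈ U, ∃ g ∈ K, g ≠ 0 ∧ m.degree g ≤ u) :
    initialIdeal m K = monomialIdeal k U := by
  apply le_antisymm
  · refine Ideal.span_le.2 ?_
    rintro _ ⟨g, hg, rfl⟩
    by_cases h0 : g = 0
    · simp [h0]
    · exact monomial_mem_monomialIdeal (hK g hg h0) _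
  · refine Ideal.span_le.2 ?_
    rintro _ ⟨u, hu, rfl⟩
    obtain ⟨g, hg, h0, hle⟩ := hU u hu
    have hlc : m.leadingCoeff g ≠ 0 := m.leadingCoeff_ne_zero_iff.2 h0
    have : monomial u (1 : k)
        = monomial (u - m.degree g) (m.leadingCoeff g)⁻¹ * m.leadingTerm g := by
      rw [MonomialOrder.leadingTerm, monomial_mul, tsub_add_cancel_of_le hle,
        inv_mul_cancel₀ hlc]
    simp only [this]
    exact Ideal.mul_mem_left _ _ (Ideal.subset_span ⟨g, hg, rfl⟩)

lemma initialIdeal_monomialIdeal (m : MonomialOrder σ) {U : Set (σ →₀ ℕ)} (hU : IsUpperSet U) :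
    initialIdeal m (monomialIdeal k U) = monomialIdeal k U := by
  refine initialIdeal_eq_monomialIdeal m (fun g hg h0 => ?_) fun u hu => ?_
  · exact (mem_monomialIdeal hU).1 hg _ (m.degree_mem_support h0)
  · refine ⟨monomial u 1, monomial_mem_monomialIdeal hu 1, by simp, ?_⟩
    classical rw [m.degree_monomial]; simp

open Classical in
/-- Multiplying by the largest variable of a linear form that kills `h` modulo a monomial ideal
destroys at least one of the terms of `h` outside that ideal. -/
lemma card_filter_support_X_mul_lt (m : MonomialOrder σ) {U : Set (σ →₀ ℕ)} (hU : IsUpperSet U)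
    {S : Finset σ} {a : σ} (ha : a ∈ S)
    (hmax : ∀ v ∈ S, Finsupp.single v 1 ≼[m] Finsupp.single a 1)
    {h : MvPolynomial σ k} (hh : h ∉ monomialIdeal k U)
    (hSh : (∑ v ∈ S, X v) * h ∈ monomialIdeal k U) :
    ((X a * h).support.filter (· ∉ U)).card < (h.support.filter (· ∉ U)).card := by
  have hne : (h.support.filter (· ∉ U)).Nonempty := by
    rw [mem_monomialIdeal hU] at hh
    push Not at hh
    obtain ⟨t, ht, htU⟩ := hh
    exact ⟨t, Finset.mem_filter.2 ⟨ht, htU⟩⟩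
  obtain ⟨t, ht, htmax⟩ := (h.support.filter (· ∉ U)).exists_max_image m.toSyn hne
  have ht' := Finset.mem_filter.1 ht
  -- The largest term of `h` outside the ideal cannot cancel against another one.
  have key : t + Finsupp.single a 1 ∈ U := by
    by_contra hcon
    have hc : coeff (t + Finsupp.single a 1) ((∑ v ∈ S, X v) * h) = 0 := by
      by_contra hc
      exact hcon ((mem_monomialIdeal hU).1 hSh _ (mem_support_iff.2 hc))
    rw [Finset.sum_mul, coeff_sum, Finset.sum_eq_single a] at hc
    · rw [add_comm, coeff_X_mul] at hc
      exact (mem_support_iff.1 ht'.1) hc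
    · intro v hv hva
      by_contra hcv
      rw [coeff_X_mul'] at hcv
      split_ifs at hcv with hvs
      · have hle : Finsupp.single v 1 ≤ t + Finsupp.single a 1 := by
          rw [Finsupp.single_le_iff]
          exact Nat.one_le_iff_ne_zero.2 (Finsupp.mem_support_iff.1 hvs)
        have heq := tsub_add_cancel_of_le hle
        set t' := t + Finsupp.single a 1 - Finsupp.single v 1
        have ht'U : t' ∉ U := fun h' => hcon (heq ▸ hU (le_self_add) h')
        have h1 := htmax t' (Finset.mem_filter.2 ⟨mem_support_iff.2 hcv, ht'U⟩)
        have h2 := hmax v hv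
        have h3 : m.toSyn t' + m.toSyn (Finsupp.single v 1)
            = m.toSyn t + m.toSyn (Finsupp.single a 1) := by
          rw [← map_add, heq, map_add]
        have h4 := ((add_eq_add_iff_eq_and_eq h1 h2).1 h3).2
        exact hva (Finsupp.single_left_injective one_ne_zero (m.toSyn.injective h4))
      · exact hcv rfl
    · exact fun h' => absurd ha h'
  calc ((X a * h).support.filter (· ∉ U)).card
      ≤ (((h.support.filter (· ∉ U)).erase t).map
          (addLeftEmbedding (Finsupp.single a 1))).card := by
        refine Finset.card_le_card fun s hs => ?_
        obtain ⟨hs, hsU⟩ := Finset.mem_filter.1 hs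
        rw [support_X_mul] at hs
        obtain ⟨s', hs', rfl⟩ := Finset.mem_map.1 hs
        simp only [addLeftEmbedding_apply] at hsU
        refine Finset.mem_map.2 ⟨s', Finset.mem_erase.2 ⟨?_, Finset.mem_filter.2 ⟨hs', ?_⟩⟩, rfl⟩
        · rintro rfl
          exact hsU (by rwa [add_comm])
        · exact fun h' => hsU (hU le_add_self h')
    _ < _ := by
        rw [Finset.card_map]
        exact Finset.card_erase_lt_of_mem ht

/-- If a sum of variables kills some `g` modulo a monomial ideal, then so do all of these variables
separately, for a possibly different `g'`. Multiplying by the largest variable removes terms outside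
the ideal, so a witness with the fewest such terms is killed by that variable; the set `T` records
the variables already treated. -/
lemma exists_forall_X_mul_mem (m : MonomialOrder σ) {U : Set (σ →₀ ℕ)} (hU : IsUpperSet U)
    (S : Finset σ) : ∀ (T : Set σ) (g : MvPolynomial σ k), g ∉ monomialIdeal k U →
    (∑ v ∈ S, X v) * g ∈ monomialIdeal k U → (∀ v ∈ T, X v * g ∈ monomialIdeal k U) →
    ∃ g' ∉ monomialIdeal k U, (∀ v ∈ T, X v * g' ∈ monomialIdeal k U) ∧
      ∀ v ∈ S, X v * g' ∈ monomialIdeal k U := by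
  classical
  induction S using Finset.induction_on_max_value
    (fun v => m.toSyn (Finsupp.single v 1)) with
  | empty => exact fun T g hg _ hT => ⟨g, hg, hT, by simp⟩
  | insert a s has hmax ih =>
    intro T g hg hS hT
    -- a witness with the fewest terms outside the ideal is killed by the largest variable
    let Good : Set (MvPolynomial σ k) := {h | h ∉ monomialIdeal k U ∧
      (∑ v ∈ insert a s, X v) * h ∈ monomialIdeal k U ∧ ∀ v ∈ T, X v * h ∈ monomialIdeal k U}
    obtain ⟨h, ⟨hh, hSh, hTh⟩, hmin⟩ :=
      (measure fun h : MvPolynomial σ k => (h.support.filter (· ∉ U)).card).wf.has_min Good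
        ⟨g, hg, hS, hT⟩
    have hah : X a * h ∈ monomialIdeal k U := by
      by_contra hcon
      refine hmin (X a * h) ⟨hcon, ?_, fun v hv => ?_⟩ ?_
      · rw [mul_left_comm]; exact Ideal.mul_mem_left _ _ hSh
      · rw [mul_left_comm]; exact Ideal.mul_mem_left _ _ (hTh v hv)
      · refine card_filter_support_X_mul_lt m hU (Finset.mem_insert_self a s) ?_ hh hSh
        intro v hv
        rcases Finset.mem_insert.1 hv with rfl | hv
        · exact le_rfl
        · exact hmax v hv
    obtain ⟨g', hg', hT', hs'⟩ := ih (insert a T) h hh (by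
      rw [Finset.sum_insert has, add_mul] at hSh
      exact (Ideal.add_mem_iff_right _ hah).1 hSh) (by
      rintro v (rfl | hv)
      · exact hah
      · exact hTh v hv)
    refine ⟨g', hg', fun v hv => hT' v (Or.inr hv), fun v hv => ?_⟩
    rcases Finset.mem_insert.1 hv with rfl | hv
    · exact hT' _ (Or.inl rfl)
    · exact hs' v hv

/-- A sum of variables is a nonzerodivisor modulo a monomial ideal as soon as no monomial outside
the ideal is multiplied into it by all of these variables. -/
lemma isSMulRegular_sum_X (m : MonomialOrder σ) {U : Set (σ →₀ ℕ)} (hU : IsUpperSet U)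
    (S : Finset σ) (hS : ∀ w ∉ U, ∃ v ∈ S, w + Finsupp.single v 1 ∉ U) :
    IsSMulRegular (MvPolynomial σ k ⧸ monomialIdeal k U) (∑ v ∈ S, X v : MvPolynomial σ k) := by
  rw [isSMulRegular_iff_right_eq_zero_of_smul]
  intro y hy
  obtain ⟨g, rfl⟩ := Ideal.Quotient.mk_surjective y
  by_contra hg
  have hg' : g ∉ monomialIdeal k U := fun h => hg (Ideal.Quotient.eq_zero_iff_mem.2 h)
  have hSg : (∑ v ∈ S, X v) * g ∈ monomialIdeal k U :=
    Ideal.Quotient.eq_zero_iff_mem.1 hy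
  obtain ⟨g', hg', -, h⟩ := exists_forall_X_mul_mem m hU S ∅ g hg' hSg (by simp)
  rw [mem_monomialIdeal hU] at hg'
  push Not at hg'
  obtain ⟨t, ht, htU⟩ := hg'
  obtain ⟨v, hv, hvU⟩ := hS t htU
  refine hvU ((mem_monomialIdeal hU).1 (h v hv) _ (mem_support_iff.2 ?_))
  rw [add_comm, coeff_X_mul]
  exact mem_support_iff.1 ht

/-- A linear functional, given by its values `φ` on monomials, that vanishes on a monomial ideal
and a sum of variables and is zero at all monomials below `u`, shows that `u` is not the
leading exponent of an element of the ideal they generate. -/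
lemma degree_ne_of_functional (m : MonomialOrder σ) {U : Set (σ →₀ ℕ)} (hU : IsUpperSet U)
    {S : Finset σ} {u : σ →₀ ℕ} (φ : (σ →₀ ℕ) → k) (hu : φ u ≠ 0)
    (hlt : ∀ t, t ≠ u → φ t ≠ 0 → u ≺[m] t) (hφU : ∀ t ∈ U, φ t = 0)
    (hφS : ∀ t, ∑ v ∈ S, φ (t + Finsupp.single v 1) = 0)
    {g : MvPolynomial σ k} (hg : g ∈ monomialIdeal k U ⊔ Ideal.span {∑ v ∈ S, X v})
    (h0 : g ≠ 0) : m.degree g ≠ u := by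
  let Φ : MvPolynomial σ k →ₗ[k] k := (basisMonomials σ k).constr k φ
  have hΦ : ∀ t (c : k), Φ (monomial t c) = c * φ t := by
    intro t c
    have : monomial t c = c • basisMonomials σ k t := by simp [smul_monomial]
    rw [this, map_smul, Module.Basis.constr_basis, smul_eq_mul]
  have hΦs : ∀ p : MvPolynomial σ k, Φ p = ∑ t ∈ p.support, coeff t p * φ t := by
    intro p
    conv_lhs => rw [p.as_sum, map_sum]
    exact Finset.sum_congr rfl fun t _ => hΦ _ _
  have hΦg : Φ g = 0 := by
    obtain ⟨p, hp, q, hq, rfl⟩ := Submodule.mem_sup.1 hg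
    obtain ⟨r, rfl⟩ := Ideal.mem_span_singleton'.1 hq
    rw [map_add, hΦs p, Finset.sum_eq_zero, zero_add]
    · conv_lhs => rw [r.as_sum, Finset.sum_mul, map_sum]
      refine Finset.sum_eq_zero fun t _ => ?_
      rw [Finset.mul_sum, map_sum]
      have : ∀ v ∈ S, Φ (monomial t (coeff t r) * X v)
          = coeff t r * φ (t + Finsupp.single v 1) := by
        intro v _
        rw [X, monomial_mul, mul_one, hΦ]
      rw [Finset.sum_congr rfl this, ← Finset.mul_sum, hφS, mul_zero]
    · intro t ht
      rw [hφU t ((mem_monomialIdeal hU).1 hp t ht), mul_zero]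
  rintro rfl
  rw [hΦs, Finset.sum_eq_single (m.degree g)] at hΦg
  · exact mul_ne_zero (m.coeff_degree_ne_zero_iff.2 h0) hu hΦg
  · intro t ht htu
    by_contra hne
    exact absurd (m.le_degree ht) (not_le.2 (hlt t htu fun h => hne (by rw [h, mul_zero])))
  · exact fun h => absurd (m.degree_mem_support h0) h

/-! ### The initial ideal after adding a sum of three variables -/

variable {σ : Type*} {k : Type*} [Field k]

lemma single_nsmul_lt (m : MonomialOrder σ) {a b : σ}
    (hab : Finsupp.single b 1 ≺[m] Finsupp.single a 1) {i : ℕ} (hi : i ≠ 0) :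
    Finsupp.single b i ≺[m] Finsupp.single a i := by
  have h : ∀ v : σ, m.toSyn (Finsupp.single v i) = i • m.toSyn (Finsupp.single v 1) := by
    intro v
    rw [← map_nsmul, Finsupp.smul_single, smul_eq_mul, mul_one]
  rw [h, h]
  exact nsmul_lt_nsmul_right hi hab

open Classical in
/-- A version of `degree_ne_of_functional` for `X c + X a + X b`, the functional being supported
on the monomials that agree with `u` outside `a`, `b`, `c`; its value `val` depends on the
exponents of `c`, `a`, `b` (in this order). -/
lemma degree_ne_of_val (m : MonomialOrder σ) {U : Set (σ →₀ ℕ)} (hU : IsUpperSet U)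
    {a b c : σ} (hac : a ≠ c) (hbc : b ≠ c) (hab : a ≠ b) {u : σ →₀ ℕ} (val : ℕ → ℕ → ℕ → k)
    (hval : val (u c) (u a) (u b) ≠ 0)
    (hsum : ∀ e i j, val (e + 1) i j + val e (i + 1) j + val e i (j + 1) = 0)
    (hvU : ∀ t, (∀ v, v ≠ a → v ≠ b → v ≠ c → t v = u v) → val (t c) (t a) (t b) ≠ 0 → t ∉ U)
    (hlt : ∀ t, (∀ v, v ≠ a → v ≠ b → v ≠ c → t v = u v) → t ≠ u →
      val (t c) (t a) (t b) ≠ 0 → u ≺[m] t)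
    {g : MvPolynomial σ k} (hg : g ∈ monomialIdeal k U ⊔ Ideal.span {X c + X a + X b})
    (h0 : g ≠ 0) : m.degree g ≠ u := by
  have hS : (X c + X a + X b : MvPolynomial σ k) = ∑ v ∈ {c, a, b}, X v := by
    rw [Finset.sum_insert (by simp [hac.symm, hbc.symm]), Finset.sum_pair hab, add_assoc]
  rw [hS] at hg
  let φ : (σ →₀ ℕ) → k := fun t =>
    if ∀ v, v ≠ a → v ≠ b → v ≠ c → t v = u v then val (t c) (t a) (t b) else 0
  refine degree_ne_of_functional m hU φ ?_ ?_ ?_ ?_ hg h0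
  · simpa [φ] using hval
  · intro t htu ht
    simp only [φ] at ht
    split_ifs at ht with h
    · exact hlt t h htu ht
    · exact absurd rfl ht
  · intro t htU
    by_contra ht
    simp only [φ] at ht
    split_ifs at ht with h
    · exact hvU t h ht htU
    · exact ht rfl
  · intro t
    rw [Finset.sum_insert (by simp [hac.symm, hbc.symm]), Finset.sum_pair hab]
    by_cases h : ∀ v, v ≠ a → v ≠ b → v ≠ c → t v = u v
    · have h' : ∀ w, w = a ∨ w = b ∨ w = c →
          ∀ v, v ≠ a → v ≠ b → v ≠ c → (t + Finsupp.single w 1 : σ →₀ ℕ) v = u v := by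
        rintro w hw v h1 h2 h3
        have : w ≠ v := by rintro rfl; tauto
        simp [Finsupp.single_eq_of_ne this.symm, h v h1 h2 h3]
      simp only [φ]
      rw [if_pos (h' c (by simp)), if_pos (h' a (by simp)), if_pos (h' b (by simp))]
      simp [hac, hbc, hab, hac.symm, hbc.symm, hab.symm, ← add_assoc, hsum]
    · have h' : ∀ w, w = a ∨ w = b ∨ w = c →
          ¬ ∀ v, v ≠ a → v ≠ b → v ≠ c → (t + Finsupp.single w 1 : σ →₀ ℕ) v = u v := by
        intro w hw hcon
        refine h fun v h1 h2 h3 => ?_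
        have : w ≠ v := by rintro rfl; tauto
        simpa [Finsupp.single_eq_of_ne this.symm] using hcon v h1 h2 h3
      simp only [φ]
      rw [if_neg (h' c (by simp)), if_neg (h' a (by simp)), if_neg (h' b (by simp))]
      simp

/-- The local shape of a monomial ideal at the path `a' - a - c - b - b'`: membership of the
exponent `t`, where `U₀` collects the generators that do not involve `a`, `b`, `c`. -/
def PathShape (a' a c b b' : σ) (U₀ : (σ →₀ ℕ) → Prop) (t : σ →₀ ℕ) : Prop :=
  (1 ≤ t c ∧ 1 ≤ t a) ∨ (1 ≤ t c ∧ 1 ≤ t b) ∨ (1 ≤ t a ∧ 1 ≤ t a') ∨ (1 ≤ t b ∧ 1 ≤ t b') ∨ U₀ t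

/-- The shape of the initial ideal after adding `X c + X a + X b` to an ideal of shape
`PathShape`. -/
def CollapsedShape (a' a c b b' : σ) (U₀ : (σ →₀ ℕ) → Prop) (t : σ →₀ ℕ) : Prop :=
  1 ≤ t c ∨ 2 ≤ t a ∨ (1 ≤ t a ∧ 1 ≤ t b) ∨ (2 ≤ t b ∧ 1 ≤ t a') ∨
    (1 ≤ t a ∧ 1 ≤ t a') ∨ (1 ≤ t b ∧ 1 ≤ t b') ∨ U₀ t

section Collapse

variable {a' a c b b' : σ} {U₀ : (σ →₀ ℕ) → Prop} {U U' : Set (σ →₀ ℕ)}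

/-- The leading exponents of the sum of an ideal of shape `PathShape` with `X c + X a + X b` lie in
the `CollapsedShape`: for every other exponent there is a functional as in
`degree_ne_of_functional`. -/
lemma degree_mem_of_collapse (m : MonomialOrder σ)
    (hca : Finsupp.single a 1 ≺[m] Finsupp.single c 1)
    (hab : Finsupp.single b 1 ≺[m] Finsupp.single a 1)
    (ha' : a' ≠ a ∧ a' ≠ b ∧ a' ≠ c) (hb' : b' ≠ a ∧ b' ≠ b ∧ b' ≠ c)
    (hU₀ : ∀ t s : σ →₀ ℕ, (∀ v, v ≠ a → v ≠ b → v ≠ c → t v = s v) → U₀ t → U₀ s)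
    (hU : IsUpperSet U) (hUs : ∀ t, t ∈ U ↔ PathShape a' a c b b' U₀ t)
    (hUs' : ∀ t, t ∈ U' ↔ CollapsedShape a' a c b b' U₀ t)
    {g : MvPolynomial σ k} (hg : g ∈ monomialIdeal k U ⊔ Ideal.span {X c + X a + X b})
    (h0 : g ≠ 0) : m.degree g ∈ U' := by
  have ac : a ≠ c := by rintro rfl; exact lt_irrefl _ hca
  have ba : a ≠ b := by rintro rfl; exact lt_irrefl _ hab
  have hcb := hab.trans hca
  have bc : b ≠ c := by rintro rfl; exact lt_irrefl _ hcb
  by_contra hu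
  generalize hdu : m.degree g = u at hu
  rw [hUs'] at hu
  simp only [CollapsedShape, not_or, not_and, not_le] at hu
  obtain ⟨hc, ha, hab1, hba', haa', hbb', h0u⟩ := hu
  have hc0 : u c = 0 := by omega
  -- exponents that agree with `u` off `a`, `b`, `c`
  have agree : ∀ t : σ →₀ ℕ, (∀ v, v ≠ a → v ≠ b → v ≠ c → t v = u v) →
      t a' = u a' ∧ t b' = u b' ∧ ¬ U₀ t := fun t ht =>
    ⟨ht a' ha'.1 ha'.2.1 ha'.2.2, ht b' hb'.1 hb'.2.1 hb'.2.2, fun h => h0u (hU₀ t u ht h)⟩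
  -- two exponents coincide once they agree everywhere
  have ext' : ∀ t : σ →₀ ℕ, (∀ v, v ≠ a → v ≠ b → v ≠ c → t v = u v) →
      t a = u a → t b = u b → t c = u c → t = u := by
    intro t ht h1 h2 h3
    ext v
    by_cases hva : v = a
    · rw [hva, h1]
    by_cases hvb : v = b
    · rw [hvb, h2]
    by_cases hvc : v = c
    · rw [hvc, h3]
    exact ht v hva hvb hvc
  -- if `t` arises from `u` by trading `x_p ^ i` for the larger `x_q ^ i`, then `t` is larger
  have swap : ∀ (t : σ →₀ ℕ) (p q : σ) (i : ℕ), i ≠ 0 →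
      Finsupp.single p 1 ≺[m] Finsupp.single q 1 →
      t + Finsupp.single p i = u + Finsupp.single q i → u ≺[m] t := by
    intro t p q i hi hpq heq
    have h1 := congrArg m.toSyn heq
    rw [map_add, map_add] at h1
    have h2 := single_nsmul_lt m hpq hi
    by_contra hcon
    exact absurd h1 (add_lt_add_of_le_of_lt (not_lt.1 hcon) h2).ne
  -- exponents that differ only in `p` and `q` by `i`
  have swap' : ∀ (t : σ →₀ ℕ) (p q : σ) (i : ℕ), p ≠ q →
      (∀ v, v ≠ p → v ≠ q → t v = u v) → t p + i = u p → t q = u q + i →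
      t + Finsupp.single p i = u + Finsupp.single q i := by
    intro t p q i hpq hv hp hq
    ext v
    by_cases hvp : v = p
    · subst hvp
      simp [Finsupp.single_eq_of_ne hpq, hp]
    by_cases hvq : v = q
    · subst hvq
      simp [Finsupp.single_eq_of_ne hvp, hq]
    simp [Finsupp.single_eq_of_ne hvp, Finsupp.single_eq_of_ne hvq, hv v hvp hvq]
  rcases Nat.lt_or_ge (u b) 2 with hb2 | hb2
  · by_cases ha0 : u a = 0
    · by_cases hb0 : u b = 0
      · -- `u` involves none of the three variables
        refine degree_ne_of_val m hU ac bc ba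
          (fun e i j => if e = 0 ∧ i = 0 ∧ j = 0 then 1 else 0) ?_ ?_ ?_ ?_ hg h0 hdu
        · simp [hc0, ha0, hb0]
        · intro e i j; simp
        · intro t ht hv
          obtain ⟨h1, h2, h3⟩ := agree t ht
          have hv' : t c = 0 ∧ t a = 0 ∧ t b = 0 := by
            by_contra h; exact hv (if_neg h)
          rw [hUs, PathShape]
          simp [hv', h3]
        · intro t ht htu hv
          have hv' : t c = 0 ∧ t a = 0 ∧ t b = 0 := by
            by_contra h; exact hv (if_neg h)
          exact absurd (ext' t ht (by omega) (by omega) (by omega)) htu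
      · -- `u = x_b w`
        have hb1 : u b = 1 := by omega
        refine degree_ne_of_val m hU ac bc ba
          (fun e i j => if e = 0 ∧ i = 0 ∧ j = 1 then 1 else
            if e = 1 ∧ i = 0 ∧ j = 0 then -1 else 0) ?_ ?_ ?_ ?_ hg h0 hdu
        · simp [hc0, ha0, hb1]
        · intro e i j
          rcases e with _ | e <;> rcases i with _ | i <;> rcases j with _ | j <;> simp
        · intro t ht hv
          obtain ⟨h1, h2, h3⟩ := agree t ht
          have hv' : (t c = 0 ∧ t a = 0 ∧ t b = 1) ∨ (t c = 1 ∧ t a = 0 ∧ t b = 0) := by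
            by_contra h
            rw [not_or] at h
            exact hv (by rw [if_neg h.1, if_neg h.2])
          rw [hUs, PathShape]
          simp only [h3, or_false]
          have := hbb'
          omega
        · intro t ht htu hv
          have hv' : (t c = 0 ∧ t a = 0 ∧ t b = 1) ∨ (t c = 1 ∧ t a = 0 ∧ t b = 0) := by
            by_contra h
            rw [not_or] at h
            exact hv (by rw [if_neg h.1, if_neg h.2])
          rcases hv' with hv' | hv'
          · exact absurd (ext' t ht (by omega) (by omega) (by omega)) htu
          · refine swap t b c 1 one_ne_zero hcb (swap' t b c 1 bc ?_ (by omega) (by omega))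
            intro v h1 h2
            by_cases hva : v = a
            · subst hva; omega
            · exact ht v hva h1 h2
    · -- `u = x_a w`
      have ha1 : u a = 1 := by omega
      have hb0 : u b = 0 := by omega
      refine degree_ne_of_val m hU ac bc ba
        (fun e i j => if e = 0 ∧ i = 1 ∧ j = 0 then 1 else
          if e = 1 ∧ i = 0 ∧ j = 0 then -1 else 0) ?_ ?_ ?_ ?_ hg h0 hdu
      · simp [hc0, ha1, hb0]
      · intro e i j
        rcases e with _ | e <;> rcases i with _ | i <;> rcases j with _ | j <;> simp
      · intro t ht hv
        obtain ⟨h1, h2, h3⟩ := agree t ht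
        have hv' : (t c = 0 ∧ t a = 1 ∧ t b = 0) ∨ (t c = 1 ∧ t a = 0 ∧ t b = 0) := by
          by_contra h
          rw [not_or] at h
          exact hv (by rw [if_neg h.1, if_neg h.2])
        rw [hUs, PathShape]
        simp only [h3, or_false]
        have := haa'
        omega
      · intro t ht htu hv
        have hv' : (t c = 0 ∧ t a = 1 ∧ t b = 0) ∨ (t c = 1 ∧ t a = 0 ∧ t b = 0) := by
          by_contra h
          rw [not_or] at h
          exact hv (by rw [if_neg h.1, if_neg h.2])
        rcases hv' with hv' | hv'
        · exact absurd (ext' t ht (by omega) (by omega) (by omega)) htu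
        · refine swap t a c 1 one_ne_zero hca (swap' t a c 1 ac ?_ (by omega) (by omega))
          intro v h1 h2
          by_cases hvb : v = b
          · subst hvb; omega
          · exact ht v h1 hvb h2
  · -- `u = x_b ^ j w` with `2 ≤ j`
    have ha0 : u a = 0 := by omega
    refine degree_ne_of_val m hU ac bc ba
      (fun e i j => if e = 0 ∧ i + j = u b then (-1) ^ i else 0) ?_ ?_ ?_ ?_ hg h0 hdu
    · simp [hc0, ha0]
    · intro e i j
      have h1 : i + 1 + j = u b ↔ i + (j + 1) = u b := by omega
      rcases e with _ | e
      · by_cases h2 : i + (j + 1) = u b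
        · simp [h1, h2, pow_succ]
        · simp [h1, h2]
      · simp
    · intro t ht hv
      obtain ⟨h1, h2, h3⟩ := agree t ht
      have hv' : t c = 0 ∧ t a + t b = u b := by
        by_contra h; exact hv (if_neg h)
      rw [hUs, PathShape]
      simp only [h3, or_false]
      omega
    · intro t ht htu hv
      have hv' : t c = 0 ∧ t a + t b = u b := by
        by_contra h; exact hv (if_neg h)
      have hta : t a ≠ 0 := fun h =>
        htu (ext' t ht (by omega) (by omega) (by omega))
      refine swap t b a (t a) hta hab (swap' t b a (t a) ba.symm ?_ (by omega) (by omega))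
      intro v h1 h2
      by_cases hvc : v = c
      · subst hvc; omega
      · exact ht v h2 h1 hvc

/-- The generators of the `CollapsedShape` are leading exponents: modulo the edges at `c`,
multiplying `X c + X a + X b` by `X a` and by `X b` gives `a² + ab` and `ab + b²`, and `b² a'` arises
because `a a'` is in the ideal. -/
lemma exists_degree_le_of_collapse (m : MonomialOrder σ)
    (hca : Finsupp.single a 1 ≺[m] Finsupp.single c 1)
    (hab : Finsupp.single b 1 ≺[m] Finsupp.single a 1)
    (hba' : b ≠ a') (hUs : ∀ t, t ∈ U ↔ PathShape a' a c b b' U₀ t)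
    {u : σ →₀ ℕ} (hu : CollapsedShape a' a c b b' U₀ u) :
    ∃ g ∈ monomialIdeal k U ⊔ Ideal.span {(X c + X a + X b : MvPolynomial σ k)},
      g ≠ 0 ∧ m.degree g ≤ u := by
  set K := monomialIdeal k U ⊔ Ideal.span {(X c + X a + X b : MvPolynomial σ k)} with hK
  have ac : a ≠ c := by rintro rfl; exact lt_irrefl _ hca
  have ba : a ≠ b := by rintro rfl; exact lt_irrefl _ hab
  have hcb := hab.trans hca
  have bc : b ≠ c := by rintro rfl; exact lt_irrefl _ hcb
  have hf : (X c + X a + X b : MvPolynomial σ k) ∈ K :=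
    Ideal.mem_sup_right (Ideal.subset_span rfl)
  have hmon : ∀ t ∈ U, (monomial t 1 : MvPolynomial σ k) ∈ K := fun t ht =>
    Ideal.mem_sup_left (monomial_mem_monomialIdeal ht 1)
  have hXX : ∀ p q : σ, (X p * X q : MvPolynomial σ k)
      = monomial (Finsupp.single p 1 + Finsupp.single q 1) 1 := by
    intro p q; rw [X, X, monomial_mul, one_mul]
  have pair : ∀ p q : σ, 1 ≤ (Finsupp.single p 1 + Finsupp.single q 1 : σ →₀ ℕ) p ∧
      1 ≤ (Finsupp.single p 1 + Finsupp.single q 1 : σ →₀ ℕ) q := by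
    intro p q; constructor <;> simp
  have hcaK : (X c * X a : MvPolynomial σ k) ∈ K := by
    rw [hXX]; exact hmon _ ((hUs _).2 (Or.inl (pair c a)))
  have hcbK : (X c * X b : MvPolynomial σ k) ∈ K := by
    rw [hXX]; exact hmon _ ((hUs _).2 (Or.inr (Or.inl (pair c b))))
  have hpos : ∀ {u : σ →₀ ℕ} {p : σ} {i : ℕ}, i ≤ u p → Finsupp.single p i ≤ u := by
    intro u p i h
    rwa [Finsupp.single_le_iff]
  have hpos2 : ∀ {u : σ →₀ ℕ} {p q : σ} {i j : ℕ}, p ≠ q → i ≤ u p → j ≤ u q →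
      Finsupp.single p i + Finsupp.single q j ≤ u := by
    intro u p q i j hpq hp hq v
    by_cases h1 : v = p
    · subst h1; simpa [Finsupp.single_eq_of_ne hpq] using hp
    by_cases h2 : v = q
    · subst h2; simpa [Finsupp.single_eq_of_ne h1] using hq
    simp [Finsupp.single_eq_of_ne h1, Finsupp.single_eq_of_ne h2]
  have ofU : ∀ t ∈ U, ∃ g ∈ K, g ≠ 0 ∧ m.degree g ≤ t := fun t ht =>
    ⟨monomial t 1, hmon t ht, by simp, by classical rw [m.degree_monomial]; simp⟩
  have binom : ∀ (s t : σ →₀ ℕ), t ≺[m] s → m.degree (monomial s (1 : k) + monomial t 1) = s ∧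
      (monomial s (1 : k) + monomial t 1) ≠ 0 := by
    intro s t hts
    classical
    have hd : m.degree (monomial s (1 : k) + monomial t 1) = s := by
      rw [m.degree_add_of_lt] <;> simp [m.degree_monomial, hts]
    refine ⟨hd, fun h0 => ?_⟩
    have := congrArg (coeff s) h0
    rw [coeff_add, coeff_monomial, coeff_monomial, if_pos rfl, if_neg] at this
    · simp at this
    · rintro rfl; exact lt_irrefl _ hts
  rcases hu with h | h | h | h | h | h | h
  · refine ⟨_, hf, ?_, ?_⟩
    · intro h0
      have := congrArg (coeff (Finsupp.single c 1)) h0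
      have hX : ∀ v : σ, v ≠ c → coeff (Finsupp.single c 1) (X v : MvPolynomial σ k) = 0 :=
        fun v hv => by
          classical
          rw [coeff_X, if_neg]
          exact fun h => hv (Finsupp.single_left_injective one_ne_zero h)
      simp [hX a ac, hX b bc] at this
    · have hd : m.degree (X c + X a + X b : MvPolynomial σ k) = Finsupp.single c 1 := by
        have h1 : m.degree (X c + X a : MvPolynomial σ k) = Finsupp.single c 1 := by
          rw [m.degree_add_of_lt] <;> simp [m.degree_X, hca]
        rw [m.degree_add_of_lt] <;> simp [m.degree_X, h1, hcb]
      rw [hd]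
      exact hpos h
  · -- `x_a² + x_a x_b`
    have hmem : monomial (Finsupp.single a 2) (1 : k)
        + monomial (Finsupp.single a 1 + Finsupp.single b 1) 1 ∈ K := by
      have : monomial (Finsupp.single a 2) (1 : k)
        + monomial (Finsupp.single a 1 + Finsupp.single b 1) 1
        = X a * (X c + X a + X b) - X c * X a := by
        rw [← hXX, ← X_pow_eq_monomial]; ring
      rw [this]
      exact K.sub_mem (K.mul_mem_left _ hf) hcaK
    have hb := binom (Finsupp.single a 2) (Finsupp.single a 1 + Finsupp.single b 1) (by
      rw [show (Finsupp.single a 2 : σ →₀ ℕ) = Finsupp.single a 1 + Finsupp.single a 1 by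
        rw [← Finsupp.single_add], map_add, map_add]
      exact add_lt_add_right hab _)
    exact ⟨_, hmem, hb.2, hb.1.le.trans (hpos h)⟩
  · -- `x_a x_b + x_b²`
    have hmem : monomial (Finsupp.single a 1 + Finsupp.single b 1) (1 : k)
        + monomial (Finsupp.single b 1 + Finsupp.single b 1) 1 ∈ K := by
      have : monomial (Finsupp.single a 1 + Finsupp.single b 1) (1 : k)
        + monomial (Finsupp.single b 1 + Finsupp.single b 1) 1
        = X b * (X c + X a + X b) - X c * X b := by
        rw [← hXX, ← hXX]; ring
      rw [this]
      exact K.sub_mem (K.mul_mem_left _ hf) hcbK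
    have hb := binom (Finsupp.single a 1 + Finsupp.single b 1)
      (Finsupp.single b 1 + Finsupp.single b 1) (by
        rw [map_add, map_add]
        exact add_lt_add_left hab _)
    exact ⟨_, hmem, hb.2, hb.1.le.trans (hpos2 ba h.1 h.2)⟩
  · -- `x_b² x_{a'} = x_{a'} (x_a x_b + x_b²) - x_b (x_a x_{a'})`
    have hmem : monomial u (1 : k) ∈ K := by
      have haa' : (X a * X a' : MvPolynomial σ k) ∈ K := by
        rw [hXX]; exact hmon _ ((hUs _).2 (Or.inr (Or.inr (Or.inl (pair a a')))))
      have h1 : (X b ^ 2 * X a' : MvPolynomial σ k) ∈ K := by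
        have : (X b ^ 2 * X a' : MvPolynomial σ k)
            = X a' * X b * (X c + X a + X b) - X a' * (X c * X b) - X b * (X a * X a') := by ring
        rw [this]
        exact K.sub_mem (K.sub_mem (K.mul_mem_left _ hf) (K.mul_mem_left _ hcbK))
          (K.mul_mem_left _ haa')
      have h2 : (X b ^ 2 * X a' : MvPolynomial σ k) ∣ monomial u 1 := by
        rw [X_pow_eq_monomial, X, monomial_mul, monomial_dvd_monomial]
        refine ⟨Or.inr ?_, by simp⟩
        exact hpos2 hba' h.1 h.2
      exact K.mem_of_dvd h2 h1
    exact ⟨_, hmem, by simp, by classical rw [m.degree_monomial]; simp⟩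
  · exact ofU _ ((hUs _).2 (Or.inr (Or.inr (Or.inl h))))
  · exact ofU _ ((hUs _).2 (Or.inr (Or.inr (Or.inr (Or.inl h)))))
  · exact ofU _ ((hUs _).2 (Or.inr (Or.inr (Or.inr (Or.inr h)))))

/-- Passing from `PathShape` to the initial ideal of the sum with `X c + X a + X b`. -/
lemma initialIdeal_collapse (m : MonomialOrder σ)
    (hca : Finsupp.single a 1 ≺[m] Finsupp.single c 1)
    (hab : Finsupp.single b 1 ≺[m] Finsupp.single a 1)
    (ha' : a' ≠ a ∧ a' ≠ b ∧ a' ≠ c) (hb' : b' ≠ a ∧ b' ≠ b ∧ b' ≠ c)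
    (hU₀ : ∀ t s : σ →₀ ℕ, (∀ v, v ≠ a → v ≠ b → v ≠ c → t v = s v) → U₀ t → U₀ s)
    (hU : IsUpperSet U) (hUs : ∀ t, t ∈ U ↔ PathShape a' a c b b' U₀ t)
    (hUs' : ∀ t, t ∈ U' ↔ CollapsedShape a' a c b b' U₀ t) :
    initialIdeal m (monomialIdeal k U ⊔ Ideal.span {X c + X a + X b}) = monomialIdeal k U' :=
  initialIdeal_eq_monomialIdeal m
    (fun _ hg h0 => degree_mem_of_collapse m hca hab ha' hb' hU₀ hU hUs hUs' hg h0)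
    fun u hu => exists_degree_le_of_collapse m hca hab ha'.2.1.symm hUs ((hUs' u).1 hu)

/-- In an ideal of shape `PathShape` the variables `a`, `b`, `c` occur to the first power only, so
a monomial annihilated by all three involves none of them. -/
lemma exists_not_mem_of_pathShape (ac : a ≠ c) (bc : b ≠ c) (ba : a ≠ b)
    (ha' : a' ≠ a ∧ a' ≠ b ∧ a' ≠ c) (hb' : b' ≠ a ∧ b' ≠ b ∧ b' ≠ c)
    (hU₀ : ∀ t s : σ →₀ ℕ, (∀ v, v ≠ a → v ≠ b → v ≠ c → t v = s v) → U₀ t → U₀ s)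
    (hUs : ∀ t, t ∈ U ↔ PathShape a' a c b b' U₀ t) (w : σ →₀ ℕ) (hw : w ∉ U) :
    w + Finsupp.single c 1 ∉ U ∨ w + Finsupp.single a 1 ∉ U ∨ w + Finsupp.single b 1 ∉ U := by
  have key : ∀ v, v = a ∨ v = b ∨ v = c → U₀ (w + Finsupp.single v 1) → U₀ w := by
    intro v hv
    refine hU₀ _ _ fun p h1 h2 h3 => ?_
    have : p ≠ v := by rintro rfl; tauto
    simp [Finsupp.single_eq_of_ne this]
  by_contra hcon
  simp only [not_or, not_not] at hcon
  obtain ⟨h1, h2, h3⟩ := hcon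
  rw [hUs, PathShape] at hw h1 h2 h3
  have kc := key c (by simp)
  have ka := key a (by simp)
  have kb := key b (by simp)
  have eq : ∀ v, (w + Finsupp.single v 1 : σ →₀ ℕ) v = w v + 1 := fun v => by simp
  have ne : ∀ p v, p ≠ v → (w + Finsupp.single v 1 : σ →₀ ℕ) p = w p := fun p v h => by
    simp [Finsupp.single_eq_of_ne h]
  rw [eq, ne a c ac, ne b c bc, ne a' c ha'.2.2, ne b' c hb'.2.2] at h1
  rw [eq, ne c a ac.symm, ne b a ba.symm, ne a' a ha'.1, ne b' a hb'.1] at h2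
  rw [eq, ne c b bc.symm, ne a b ba, ne a' b ha'.2.1, ne b' b hb'.2.1] at h3
  have hw0 : ¬ U₀ w := fun h => hw (by simp [h])
  have kc' := mt kc hw0
  have ka' := mt ka hw0
  have kb' := mt kb hw0
  simp only [hw0, kc', ka', kb', or_false] at h1 h2 h3 hw
  clear kc ka kb kc' ka' kb' hw0 key hU₀ hUs
  omega

end Collapse

/-! ### Edge ideals as monomial ideals -/

section EdgeIdeal

variable {V : Type*} {k : Type*} [Field k]

/-- The exponents of the monomials in the edge ideal of `G` plus the variables in `K`. -/
def edgeExponents (G : SimpleGraph V) (K : Set V) : Set (V →₀ ℕ) :=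
  {t | (∃ v ∈ K, 1 ≤ t v) ∨ ∃ p q, G.Adj p q ∧ 1 ≤ t p ∧ 1 ≤ t q}

lemma isUpperSet_edgeExponents (G : SimpleGraph V) (K : Set V) :
    IsUpperSet (edgeExponents G K) := by
  rintro t s hts (⟨v, hv, h⟩ | ⟨p, q, hpq, hp, hq⟩)
  · exact Or.inl ⟨v, hv, h.trans (hts v)⟩
  · exact Or.inr ⟨p, q, hpq, hp.trans (hts p), hq.trans (hts q)⟩

lemma edgeIdeal_eq_monomialIdeal (G : SimpleGraph V) :
    edgeIdeal k G = monomialIdeal k (edgeExponents G ∅) := by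
  apply le_antisymm
  · refine Ideal.span_le.2 ?_
    rintro _ ⟨u, v, huv, rfl⟩
    rw [X, X, monomial_mul, one_mul]
    exact monomial_mem_monomialIdeal (Or.inr ⟨u, v, huv, by simp, by simp⟩) 1
  · refine Ideal.span_le.2 ?_
    rintro _ ⟨t, (⟨v, hv, -⟩ | ⟨p, q, hpq, hp, hq⟩), rfl⟩
    · exact absurd hv (Set.notMem_empty v)
    · refine Ideal.mem_of_dvd _ ?_ (Ideal.subset_span ⟨p, q, hpq, rfl⟩)
      rw [X, X, monomial_mul, one_mul, monomial_dvd_monomial]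
      refine ⟨Or.inr fun v => ?_, one_dvd 1⟩
      by_cases h1 : v = p
      · subst h1; simpa [Finsupp.single_eq_of_ne hpq.ne] using hp
      by_cases h2 : v = q
      · subst h2; simpa [Finsupp.single_eq_of_ne h1] using hq
      simp [Finsupp.single_eq_of_ne h1, Finsupp.single_eq_of_ne h2]

end EdgeIdeal

/-! ### The cycle: the ideals of the successive stages -/

section Cycle

variable {n : ℕ}

/-- The vertex with label `i + 1`, so that vertices are counted from `0`. -/
def idx (n i : ℕ) : Fin (3 * n + 2) := Fin.ofNat (3 * n + 2) i

lemma val_idx {i : ℕ} (hi : i < 3 * n + 2) : (idx n i).val = i := by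
  simp [idx, Fin.ofNat, Nat.mod_eq_of_lt hi]

/-- The centre of the `j`-th triple of consecutive vertices. -/
def center (n j : ℕ) : Fin (3 * n + 2) := idx n (3 * j)

/-- The vertex before the centre of the `j`-th triple. -/
def left (n j : ℕ) : Fin (3 * n + 2) := idx n (if j = 0 then 3 * n + 1 else 3 * j - 1)

/-- The vertex after the centre of the `j`-th triple. -/
def right (n j : ℕ) : Fin (3 * n + 2) := idx n (3 * j + 1)

/-- The vertex before the `j`-th triple. -/
def before (n j : ℕ) : Fin (3 * n + 2) := idx n (if j = 0 then 3 * n else 3 * j - 2)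

/-- The vertex after the `j`-th triple. -/
def after (n j : ℕ) : Fin (3 * n + 2) := idx n (3 * j + 2)

lemma val_center {j : ℕ} (hj : j < n) : (center n j).val = 3 * j := val_idx (by omega)

lemma val_left {j : ℕ} (hj : j < n) :
    (left n j).val = if j = 0 then 3 * n + 1 else 3 * j - 1 := val_idx (by split_ifs <;> omega)

lemma val_right {j : ℕ} (hj : j < n) : (right n j).val = 3 * j + 1 := val_idx (by omega)

lemma val_before {j : ℕ} (hj : j < n) :
    (before n j).val = if j = 0 then 3 * n else 3 * j - 2 := val_idx (by split_ifs <;> omega)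

lemma val_after {j : ℕ} (hj : j < n) : (after n j).val = 3 * j + 2 := val_idx (by omega)

lemma cycle_adj {u v : Fin (3 * n + 2)} :
    (SimpleGraph.cycleGraph (3 * n + 2)).Adj u v ↔ u.val + 1 = v.val ∨ v.val + 1 = u.val ∨
      (u.val = 0 ∧ v.val = 3 * n + 1) ∨ (v.val = 0 ∧ u.val = 3 * n + 1) := by
  rw [SimpleGraph.cycleGraph_adj']
  have hu := u.isLt
  have hv := v.isLt
  rcases lt_trichotomy u v with h | h | h
  · rw [Fin.sub_val_of_le h.le, Fin.coe_sub_iff_lt.2 h]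
    rw [Fin.lt_def] at h
    omega
  · subst h
    have h0 : (u - u).val = 0 := by simp
    rw [h0]
    omega
  · rw [Fin.sub_val_of_le h.le, Fin.coe_sub_iff_lt.2 h]
    rw [Fin.lt_def] at h
    omega

lemma adj_center {j : ℕ} (hj : j < n) {q : Fin (3 * n + 2)} :
    (SimpleGraph.cycleGraph (3 * n + 2)).Adj (center n j) q ↔ q = left n j ∨ q = right n j := by
  rw [cycle_adj, Fin.ext_iff, Fin.ext_iff, val_center hj, val_left hj, val_right hj]
  have := q.isLt
  split_ifs <;> omega

lemma adj_left {j : ℕ} (hj : j < n) {q : Fin (3 * n + 2)} :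
    (SimpleGraph.cycleGraph (3 * n + 2)).Adj (left n j) q ↔ q = center n j ∨ q = before n j := by
  rw [cycle_adj, Fin.ext_iff, Fin.ext_iff, val_center hj, val_left hj, val_before hj]
  have := q.isLt
  by_cases h : j = 0
  · rw [if_pos h, if_pos h]; omega
  · rw [if_neg h, if_neg h]; omega

lemma adj_right {j : ℕ} (hj : j < n) {q : Fin (3 * n + 2)} :
    (SimpleGraph.cycleGraph (3 * n + 2)).Adj (right n j) q ↔ q = center n j ∨ q = after n j := by
  rw [cycle_adj, Fin.ext_iff, Fin.ext_iff, val_center hj, val_right hj, val_after hj]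
  have := q.isLt
  omega

/-- The conditions on an exponent contributed by the `j`-th triple once its linear form has been
used. -/
def tripleExponents (n j : ℕ) (t : Fin (3 * n + 2) →₀ ℕ) : Prop :=
  1 ≤ t (center n j) ∨ 2 ≤ t (left n j) ∨ (1 ≤ t (left n j) ∧ 1 ≤ t (right n j)) ∨
    (2 ≤ t (right n j) ∧ 1 ≤ t (before n j))

/-- The exponents of the monomials in the ideal obtained from the first `i` linear forms. -/
def stageExponents (n i : ℕ) : Set (Fin (3 * n + 2) →₀ ℕ) :=
  {t | (∃ p q, (SimpleGraph.cycleGraph (3 * n + 2)).Adj p q ∧ 1 ≤ t p ∧ 1 ≤ t q) ∨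
    ∃ j < i, tripleExponents n j t}

lemma isUpperSet_stageExponents (n i : ℕ) : IsUpperSet (stageExponents n i) := by
  rintro t s hts (⟨p, q, hpq, hp, hq⟩ | ⟨j, hj, h⟩)
  · exact Or.inl ⟨p, q, hpq, hp.trans (hts p), hq.trans (hts q)⟩
  · refine Or.inr ⟨j, hj, ?_⟩
    have h1 := hts (center n j)
    have h2 := hts (left n j)
    have h3 := hts (right n j)
    have h4 := hts (before n j)
    unfold tripleExponents at h ⊢
    omega

/-- The generators of the `i`-th stage not involving the `i`-th triple. -/
def awayExponents (n i : ℕ) (t : Fin (3 * n + 2) →₀ ℕ) : Prop :=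
  (∃ p q, (SimpleGraph.cycleGraph (3 * n + 2)).Adj p q ∧
    (p ≠ left n i ∧ p ≠ right n i ∧ p ≠ center n i) ∧
    (q ≠ left n i ∧ q ≠ right n i ∧ q ≠ center n i) ∧ 1 ≤ t p ∧ 1 ≤ t q) ∨
    ∃ j < i, tripleExponents n j t

lemma triple_ne {i : ℕ} (hi : i < n) :
    left n i ≠ center n i ∧ right n i ≠ center n i ∧ left n i ≠ right n i := by
  simp only [ne_eq, Fin.ext_iff, val_left hi, val_right hi, val_center hi]
  split_ifs <;> omega

lemma before_ne {i : ℕ} (hi : i < n) :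
    before n i ≠ left n i ∧ before n i ≠ right n i ∧ before n i ≠ center n i := by
  simp only [ne_eq, Fin.ext_iff, val_left hi, val_right hi, val_center hi, val_before hi]
  split_ifs <;> omega

lemma after_ne {i : ℕ} (hi : i < n) :
    after n i ≠ left n i ∧ after n i ≠ right n i ∧ after n i ≠ center n i := by
  simp only [ne_eq, Fin.ext_iff, val_left hi, val_right hi, val_center hi, val_after hi]
  split_ifs <;> omega

lemma awayExponents_congr {i : ℕ} (hi : i < n) (t s : Fin (3 * n + 2) →₀ ℕ)
    (hts : ∀ v, v ≠ left n i → v ≠ right n i → v ≠ center n i → t v = s v)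
    (ht : awayExponents n i t) : awayExponents n i s := by
  rcases ht with ⟨p, q, hpq, hp, hq, h1, h2⟩ | ⟨j, hj, h⟩
  · refine Or.inl ⟨p, q, hpq, hp, hq, ?_, ?_⟩
    · rwa [← hts p hp.1 hp.2.1 hp.2.2]
    · rwa [← hts q hq.1 hq.2.1 hq.2.2]
  · refine Or.inr ⟨j, hj, ?_⟩
    have hjn : j < n := hj.trans hi
    have aux : ∀ v : Fin (3 * n + 2), v.val ≠ (left n i).val → v.val ≠ (right n i).val →
        v.val ≠ (center n i).val → t v = s v := fun v h1 h2 h3 =>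
      hts v (fun h => h1 (h ▸ rfl)) (fun h => h2 (h ▸ rfl)) (fun h => h3 (h ▸ rfl))
    rw [val_left hi, val_right hi, val_center hi, if_neg (by omega)] at aux
    have h1 := aux (center n j) (by rw [val_center hjn]; omega) (by rw [val_center hjn]; omega)
      (by rw [val_center hjn]; omega)
    have h2 := aux (left n j) (by rw [val_left hjn]; split_ifs <;> omega)
      (by rw [val_left hjn]; split_ifs <;> omega) (by rw [val_left hjn]; split_ifs <;> omega)
    have h3 := aux (right n j) (by rw [val_right hjn]; omega) (by rw [val_right hjn]; omega)
      (by rw [val_right hjn]; omega)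
    have h4 := aux (before n j) (by rw [val_before hjn]; split_ifs <;> omega)
      (by rw [val_before hjn]; split_ifs <;> omega) (by rw [val_before hjn]; split_ifs <;> omega)
    unfold tripleExponents at h ⊢
    rwa [← h1, ← h2, ← h3, ← h4]

lemma mem_stageExponents_iff {i : ℕ} (hi : i < n) (t : Fin (3 * n + 2) →₀ ℕ) :
    t ∈ stageExponents n i ↔
      PathShape (before n i) (left n i) (center n i) (right n i) (after n i)
        (awayExponents n i) t := by
  constructor
  · rintro (⟨p, q, hpq, hp, hq⟩ | h)
    · have main : ∀ p q, (SimpleGraph.cycleGraph (3 * n + 2)).Adj p q → 1 ≤ t p → 1 ≤ t q →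
          (p = left n i ∨ p = right n i ∨ p = center n i) →
          PathShape (before n i) (left n i) (center n i) (right n i) (after n i)
            (awayExponents n i) t := by
        rintro p q hpq hp hq (rfl | rfl | rfl)
        · rcases (adj_left hi).1 hpq with rfl | rfl
          · exact Or.inl ⟨hq, hp⟩
          · exact Or.inr (Or.inr (Or.inl ⟨hp, hq⟩))
        · rcases (adj_right hi).1 hpq with rfl | rfl
          · exact Or.inr (Or.inl ⟨hq, hp⟩)
          · exact Or.inr (Or.inr (Or.inr (Or.inl ⟨hp, hq⟩)))
        · rcases (adj_center hi).1 hpq with rfl | rfl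
          · exact Or.inl ⟨hp, hq⟩
          · exact Or.inr (Or.inl ⟨hp, hq⟩)
      by_cases h1 : p = left n i ∨ p = right n i ∨ p = center n i
      · exact main p q hpq hp hq h1
      by_cases h2 : q = left n i ∨ q = right n i ∨ q = center n i
      · exact main q p hpq.symm hq hp h2
      simp only [not_or] at h1 h2
      exact Or.inr (Or.inr (Or.inr (Or.inr (Or.inl ⟨p, q, hpq, h1, h2, hp, hq⟩))))
    · exact Or.inr (Or.inr (Or.inr (Or.inr (Or.inr h))))
  · rintro (h | h | h | h | ⟨p, q, hpq, -, -, hp, hq⟩ | h)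
    · exact Or.inl ⟨_, _, (adj_center hi).2 (Or.inl rfl), h⟩
    · exact Or.inl ⟨_, _, (adj_center hi).2 (Or.inr rfl), h⟩
    · exact Or.inl ⟨_, _, (adj_left hi).2 (Or.inr rfl), h⟩
    · exact Or.inl ⟨_, _, (adj_right hi).2 (Or.inr rfl), h⟩
    · exact Or.inl ⟨p, q, hpq, hp, hq⟩
    · exact Or.inr h

lemma mem_stageExponents_succ_iff {i : ℕ} (hi : i < n) (t : Fin (3 * n + 2) →₀ ℕ) :
    t ∈ stageExponents n (i + 1) ↔
      CollapsedShape (before n i) (left n i) (center n i) (right n i) (after n i)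
        (awayExponents n i) t := by
  have h1 : t ∈ stageExponents n (i + 1) ↔ t ∈ stageExponents n i ∨ tripleExponents n i t := by
    constructor
    · rintro (h | ⟨j, hj, h⟩)
      · exact Or.inl (Or.inl h)
      · rcases Nat.lt_succ_iff_lt_or_eq.1 hj with hj | rfl
        · exact Or.inl (Or.inr ⟨j, hj, h⟩)
        · exact Or.inr h
    · rintro ((h | ⟨j, hj, h⟩) | h)
      · exact Or.inl h
      · exact Or.inr ⟨j, by omega, h⟩
      · exact Or.inr ⟨i, by omega, h⟩
  rw [h1, mem_stageExponents_iff hi, PathShape, CollapsedShape, tripleExponents]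
  tauto

variable (k : Type*) [Field k]

lemma cycleForm_succ {i : ℕ} (hi : i < n) :
    cycleForm k n (i + 1) = X (center n i) + X (left n i) + X (right n i) := by
  unfold cycleForm x vtx center left right idx
  by_cases h0 : i = 0
  · subst h0; simp
  · rw [if_neg (by omega), if_pos (by omega), if_neg h0]
    have h1 : 3 * (i + 1) - 2 - 1 = 3 * i := by omega
    have h2 : 3 * (i + 1) - 3 - 1 = 3 * i - 1 := by omega
    have h3 : 3 * (i + 1) - 1 - 1 = 3 * i + 1 := by omega
    rw [h1, h2, h3]

/-- The variables of the last linear form. -/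
def lastVars (n : ℕ) : Finset (Fin (3 * n + 2)) :=
  insert (idx n (3 * n - 1)) (insert (idx n (3 * n)) ((Finset.range n).image (right n)))

lemma right_injOn : Set.InjOn (right n) (Finset.range n : Set ℕ) := by
  intro i hi j hj hij
  have h := congrArg Fin.val hij
  rw [Finset.coe_range] at hi hj
  rw [val_right hi, val_right hj] at h
  omega

lemma cycleForm_last (hn : 1 ≤ n) : cycleForm k n (n + 1) = ∑ v ∈ lastVars n, X v := by
  rw [lastVars, Finset.sum_insert, Finset.sum_insert, Finset.sum_image right_injOn]
  · unfold cycleForm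
    rw [if_neg (by omega), if_neg (by omega), ← add_assoc]
    congr 1
    refine Finset.sum_nbij' (fun j => j - 1) (fun j => j + 1) ?_ ?_ ?_ ?_ ?_
    · intro j hj; rw [Finset.mem_Icc] at hj; rw [Finset.mem_range]; omega
    · intro j hj; rw [Finset.mem_range] at hj; rw [Finset.mem_Icc]; omega
    · intro j hj; rw [Finset.mem_Icc] at hj; omega
    · intro j hj; omega
    · intro j hj
      rw [Finset.mem_Icc] at hj
      have : 3 * j - 1 - 1 = 3 * (j - 1) + 1 := by omega
      unfold x vtx right idx
      rw [this]
  · simp only [Finset.mem_image, Finset.mem_range, not_exists, not_and]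
    intro j hj h
    have h := congrArg Fin.val h
    rw [val_right hj, val_idx (by omega)] at h
    omega
  · simp only [Finset.mem_insert, Finset.mem_image, Finset.mem_range, not_exists, not_and, not_or]
    constructor
    · intro h
      have h := congrArg Fin.val h
      rw [val_idx (by omega), val_idx (by omega)] at h
      omega
    · intro j hj h
      have h := congrArg Fin.val h
      rw [val_right hj, val_idx (by omega)] at h
      omega

/-- If multiplying by a variable `v` of the last form takes a monomial `w` into the ideal of the
last stage, then `w` contains a witness. -/
lemma mem_stageExponents_add_single {v : Fin (3 * n + 2)} (hv : v ∈ lastVars n)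
    {w : Fin (3 * n + 2) →₀ ℕ} (hw : w ∉ stageExponents n n)
    (h : w + Finsupp.single v 1 ∈ stageExponents n n) :
    (∃ q, (SimpleGraph.cycleGraph (3 * n + 2)).Adj v q ∧ 1 ≤ w q) ∨
    ∃ j < n, (v = right n j ∧ 1 ≤ w (left n j)) ∨
      (v = right n j ∧ 1 ≤ w v ∧ 1 ≤ w (before n j)) ∨ (v = before n j ∧ 2 ≤ w (right n j)) := by
  have eq : (w + Finsupp.single v 1 : Fin (3 * n + 2) →₀ ℕ) v = w v + 1 := by simp
  have ne : ∀ p, p ≠ v → (w + Finsupp.single v 1 : Fin (3 * n + 2) →₀ ℕ) p = w p :=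
    fun p h => by simp [Finsupp.single_eq_of_ne h]
  rcases h with ⟨p, q, hpq, hp, hq⟩ | ⟨j, hj, h⟩
  · left
    by_cases h1 : p = v
    · subst h1
      exact ⟨q, hpq, by rwa [ne q hpq.ne'] at hq⟩
    by_cases h2 : q = v
    · subst h2
      exact ⟨p, hpq.symm, by rwa [ne p hpq.ne] at hp⟩
    rw [ne p h1] at hp
    rw [ne q h2] at hq
    exact absurd (Or.inl ⟨p, q, hpq, hp, hq⟩) hw
  · right
    have hw' : ¬ tripleExponents n j w := fun h => hw (Or.inr ⟨j, hj, h⟩)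
    refine ⟨j, hj, ?_⟩
    have hvv : v.val = 3 * n - 1 ∨ v.val = 3 * n ∨ ∃ i < n, v.val = 3 * i + 1 := by
      simp only [lastVars, Finset.mem_insert, Finset.mem_image, Finset.mem_range] at hv
      rcases hv with rfl | rfl | ⟨i, hi, rfl⟩
      · exact Or.inl (val_idx (by omega))
      · exact Or.inr (Or.inl (val_idx (by omega)))
      · exact Or.inr (Or.inr ⟨i, hi, val_right hi⟩)
    have hc : center n j ≠ v := by
      intro h
      have h := congrArg Fin.val h
      rw [val_center hj] at h
      rcases hvv with hvv | hvv | ⟨i, hi, hvv⟩ <;> omega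
    have hl : left n j ≠ v := by
      intro h
      have h := congrArg Fin.val h
      rw [val_left hj] at h
      rcases hvv with hvv | hvv | ⟨i, hi, hvv⟩ <;> split_ifs at h <;> omega
    clear hvv
    have hrb : right n j ≠ before n j := (before_ne hj).2.1.symm
    unfold tripleExponents at h hw'
    rw [ne _ hc, ne _ hl] at h
    by_cases hr : right n j = v
    · rw [ne (before n j) (fun h' => hrb (hr.trans h'.symm)), hr, eq] at h
      rw [hr] at hw'
      simp only [hr, true_and]
      omega
    · rw [ne _ hr] at h
      by_cases hb : before n j = v
      · rw [hb, eq] at h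
        rw [hb] at hw'
        simp only [hb, true_and]
        omega
      · rw [ne _ hb] at h
        exact absurd h hw'

/-- Modulo the last stage, no monomial is annihilated by all variables of the last form: such a
monomial would be divisible by the variable at `right n (n - 1)`, hence, going down, by all of
those at `right n j`, but also by the variable at `left n 0`. -/
lemma exists_mem_lastVars (hn : 1 ≤ n) (w : Fin (3 * n + 2) →₀ ℕ) (hw : w ∉ stageExponents n n) :
    ∃ v ∈ lastVars n, w + Finsupp.single v 1 ∉ stageExponents n n := by
  by_contra hcon
  push Not at hcon
  have hedge : ∀ p q, (SimpleGraph.cycleGraph (3 * n + 2)).Adj p q → 1 ≤ w p → 1 ≤ w q → False :=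
    fun p q hpq hp hq => hw (Or.inl ⟨p, q, hpq, hp, hq⟩)
  have htri : ∀ j < n, ¬ tripleExponents n j w := fun j hj h => hw (Or.inr ⟨j, hj, h⟩)
  -- a variable of the last form dividing `w`
  have hdiv : ∀ v ∈ lastVars n, 1 ≤ w v → ∃ j < n, v = right n j ∧ 1 ≤ w (before n j) := by
    intro v hv hwv
    rcases mem_stageExponents_add_single hv hw (hcon v hv) with
      ⟨q, hvq, hq⟩ | ⟨j, hj, ⟨rfl, h⟩ | ⟨h1, -, h2⟩ | ⟨rfl, h⟩⟩
    · exact absurd hq fun hq => hedge v q hvq hwv hq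
    · exact absurd (Or.inr (Or.inr (Or.inl ⟨h, hwv⟩))) (htri j hj)
    · exact ⟨j, hj, h1, h2⟩
    · exact absurd (Or.inr (Or.inr (Or.inr ⟨h, hwv⟩))) (htri j hj)
  have hr : ∀ j < n, right n j ∈ lastVars n := fun j hj => by
    simp only [lastVars, Finset.mem_insert, Finset.mem_image, Finset.mem_range]
    exact Or.inr (Or.inr ⟨j, hj, rfl⟩)
  have hu : idx n (3 * n - 1) ∈ lastVars n := by simp [lastVars]
  have hv : idx n (3 * n) ∈ lastVars n := by simp [lastVars]
  have hwu : w (idx n (3 * n - 1)) = 0 := by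
    by_contra h
    obtain ⟨j, hj, h, -⟩ := hdiv _ hu (by omega)
    have h := congrArg Fin.val h
    rw [val_right hj, val_idx (by omega)] at h
    omega
  have hwv : w (idx n (3 * n)) = 0 := by
    by_contra h
    obtain ⟨j, hj, h, -⟩ := hdiv _ hv (by omega)
    have h := congrArg Fin.val h
    rw [val_right hj, val_idx (by omega)] at h
    omega
  have hbefore : before n 0 = idx n (3 * n) := by simp [before]
  have hbefore' : ∀ j, before n (j + 1) = right n j := fun j => by
    simp only [before, right, Nat.succ_ne_zero, if_false]
    congr 1
  have hdown : ∀ j < n, 1 ≤ w (right n j) → 1 ≤ w (before n j) := by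
    intro j hj h
    obtain ⟨i, hi, hij, h'⟩ := hdiv _ (hr j hj) h
    rwa [right_injOn (by simpa using hj) (by simpa using hi) hij]
  have hright : ∀ j < n, ¬ 1 ≤ w (right n j) := by
    intro j
    induction j with
    | zero =>
      intro h0 h
      have := hdown 0 h0 h
      rw [hbefore] at this
      omega
    | succ j ih =>
      intro hj h
      have := hdown (j + 1) hj h
      rw [hbefore' j] at this
      exact ih (by omega) this
  rcases mem_stageExponents_add_single hu hw (hcon _ hu) with
    ⟨q, hvq, hq⟩ | ⟨j, hj, ⟨h, -⟩ | ⟨h, -⟩ | ⟨-, h⟩⟩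
  · rw [cycle_adj, val_idx (by omega)] at hvq
    have hqv : q.val = 3 * n ∨ q.val = 3 * (n - 1) + 1 := by omega
    rcases hqv with hqv | hqv
    · have : q = idx n (3 * n) := Fin.ext (by rw [val_idx (by omega), hqv])
      rw [this] at hq
      omega
    · have : q = right n (n - 1) := Fin.ext (by rw [val_right (by omega), hqv])
      rw [this] at hq
      exact hright _ (by omega) hq
  · have h := congrArg Fin.val h
    rw [val_right hj, val_idx (by omega)] at h
    omega
  · have h := congrArg Fin.val h
    rw [val_right hj, val_idx (by omega)] at h
    omega
  · exact hright j hj (by omega)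

variable {k}

lemma initialIdeal_stage (m : MonomialOrder (Fin (3 * n + 2))) (hm : IsAdmissible m)
    {i : ℕ} (hi : i < n) :
    initialIdeal m (monomialIdeal k (stageExponents n i) ⊔ Ideal.span {cycleForm k n (i + 1)})
      = monomialIdeal k (stageExponents n (i + 1)) := by
  rw [cycleForm_succ k hi]
  have hord : VarGT m (3 * i + 1) (if i = 0 then 3 * n + 2 else 3 * i) ∧
      VarGT m (if i = 0 then 3 * n + 2 else 3 * i) (3 * i + 2) := by
    by_cases h0 : i = 0
    · subst h0; simpa using hm.first
    · have := hm.later (i + 1) (by omega) (by omega)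
      rw [if_neg h0]
      exact this
  have hleft : vtx n (if i = 0 then 3 * n + 2 else 3 * i) = left n i := by
    unfold vtx left idx
    split_ifs <;> rfl
  have h1 : Finsupp.single (left n i) 1 ≺[m] Finsupp.single (center n i) 1 := by
    rw [← hleft]; exact hord.1
  have h2 : Finsupp.single (right n i) 1 ≺[m] Finsupp.single (left n i) 1 := by
    rw [← hleft]; exact hord.2
  exact initialIdeal_collapse m h1 h2 (before_ne hi) (after_ne hi) (awayExponents_congr hi)
    (isUpperSet_stageExponents n i) (mem_stageExponents_iff hi)
    (mem_stageExponents_succ_iff hi)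

lemma stageIdeal_eq (m : MonomialOrder (Fin (3 * n + 2))) (hm : IsAdmissible m)
    {i : ℕ} (hi : i ≤ n) :
    stageIdeal m (edgeIdeal k (SimpleGraph.cycleGraph (3 * n + 2))) (cycleForm k n) i
      = monomialIdeal k (stageExponents n i) := by
  induction i with
  | zero =>
    have : edgeExponents (SimpleGraph.cycleGraph (3 * n + 2)) ∅ = stageExponents n 0 := by
      ext t; simp [edgeExponents, stageExponents]
    rw [stageIdeal, edgeIdeal_eq_monomialIdeal, this,
      initialIdeal_monomialIdeal m (isUpperSet_stageExponents n 0)]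
  | succ i ih =>
    rw [stageIdeal, ih (by omega), initialIdeal_stage m hm (by omega)]

lemma cycleForm_eq_sum (hn : 1 ≤ n) {i : ℕ} (hi : i ≤ n) :
    ∃ S : Finset (Fin (3 * n + 2)), cycleForm k n (i + 1) = ∑ v ∈ S, X v ∧ S.Nonempty ∧
      ∀ w ∉ stageExponents n i, ∃ v ∈ S, w + Finsupp.single v 1 ∉ stageExponents n i := by
  rcases hi.lt_or_eq with hi | rfl
  · obtain ⟨ac, bc, ab⟩ := triple_ne hi
    refine ⟨{center n i, left n i, right n i}, ?_, by simp, fun w hw => ?_⟩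
    · rw [cycleForm_succ k hi, Finset.sum_insert (by simp [ac.symm, bc.symm]),
        Finset.sum_pair ab, add_assoc]
    · have := exists_not_mem_of_pathShape ac bc ab (before_ne hi) (after_ne hi)
        (awayExponents_congr hi) (mem_stageExponents_iff hi) w hw
      simpa using this
  · exact ⟨lastVars i, cycleForm_last k hn, by simp [lastVars], exists_mem_lastVars hn⟩

lemma sum_X_notMem_range_C {σ : Type*} {S : Finset σ} (hS : S.Nonempty) :
    (∑ v ∈ S, X v : MvPolynomial σ k) ∉ Set.range (C : k → MvPolynomial σ k) := by
  classical
  rintro ⟨c, hc⟩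
  obtain ⟨v, hv⟩ := hS
  have h := congrArg (coeff (Finsupp.single v 1)) hc
  rw [coeff_C, if_neg (by simp [eq_comm]), coeff_sum, Finset.sum_eq_single v] at h
  · simp at h
  · intro u _ huv
    rw [coeff_X, if_neg]
    exact fun h => huv (Finsupp.single_left_injective one_ne_zero h)
  · exact fun h => absurd hv h

lemma edgeIdeal_ne_top {V : Type*} (G : SimpleGraph V) : edgeIdeal k G ≠ ⊤ := by
  rw [edgeIdeal_eq_monomialIdeal, Ne, Ideal.eq_top_iff_one,
    mem_monomialIdeal (isUpperSet_edgeExponents G ∅)]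
  intro h
  have := h 0 (by simp)
  simp [edgeExponents] at this

theorem isInitiallyRegular_cycleForm (hn : 1 ≤ n) (m : MonomialOrder (Fin (3 * n + 2)))
    (hm : IsAdmissible m) :
    IsInitiallyRegular m (edgeIdeal k (SimpleGraph.cycleGraph (3 * n + 2)))
      (cycleForm k n) (n + 1) where
  ne_top := edgeIdeal_ne_top _
  nonconstant i hi := by
    obtain ⟨S, hS, hne, -⟩ := cycleForm_eq_sum (k := k) hn (Nat.lt_succ_iff.1 hi)
    rw [hS]
    exact sum_X_notMem_range_C hne
  regular i hi := by
    obtain ⟨S, hS, -, hw⟩ := cycleForm_eq_sum (k := k) hn (Nat.lt_succ_iff.1 hi)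
    rw [stageIdeal_eq m hm (Nat.lt_succ_iff.1 hi), hS]
    exact isSMulRegular_sum_X m (isUpperSet_stageExponents n i) S hw

lemma exists_lex_order.{u} {σ : Type u} [Finite σ] (r : σ → ℕ) (hr : Function.Injective r) :
    ∃ m : MonomialOrder.{u, u} σ,
      ∀ a b, r a < r b → Finsupp.single b 1 ≺[m] Finsupp.single a 1 := by
  let _ : LinearOrder σ := LinearOrder.lift' r hr
  have : WellFoundedGT σ := inferInstance
  refine ⟨MonomialOrder.lex, fun a b hab => ?_⟩
  rw [MonomialOrder.lex_lt_iff]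
  exact Finsupp.Lex.single_lt_iff.2 hab

theorem exists_isAdmissible (hn : 1 ≤ n) :
    ∃ m : MonomialOrder.{0, 0} (Fin (3 * n + 2)), IsAdmissible m := by
  -- centres first, then the vertices before them, then the remaining ones
  let cls : ℕ → ℕ := fun i => if i % 3 = 0 then 0 else if i % 3 = 2 ∨ i = 3 * n + 1 then 1 else 2
  obtain ⟨m, hm⟩ := exists_lex_order
    (fun v : Fin (3 * n + 2) => cls v.val * (3 * n + 2) + v.val) (by
      intro u v huv
      have h := congrArg (· % (3 * n + 2)) huv
      simp only [Nat.mul_add_mod_self_right, Nat.mod_eq_of_lt u.isLt,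
        Nat.mod_eq_of_lt v.isLt] at h
      exact Fin.ext h)
  have key : ∀ i j : ℕ, 1 ≤ i → i ≤ 3 * n + 2 → 1 ≤ j → j ≤ 3 * n + 2 →
      cls (i - 1) < cls (j - 1) → VarGT m i j := by
    intro i j h1 h2 h3 h4 hij
    refine hm _ _ ?_
    have hi : (vtx n i).val = i - 1 := val_idx (by omega)
    have hj : (vtx n j).val = j - 1 := val_idx (by omega)
    rw [hi, hj]
    have := Nat.mul_le_mul_right (3 * n + 2) (Nat.succ_le_of_lt hij)
    rw [Nat.succ_mul] at this
    omega
  have h0 : ∀ i, i % 3 = 0 → cls i = 0 := fun i hi => if_pos hi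
  have h1 : ∀ i, i % 3 = 2 ∨ i = 3 * n + 1 → cls i = 1 := fun i hi => by
    simp only [cls]; rw [if_neg (by omega), if_pos hi]
  have h2 : ∀ i, i % 3 = 1 → i ≠ 3 * n + 1 → cls i = 2 := fun i hi hi' => by
    simp only [cls]; rw [if_neg (by omega), if_neg (by omega)]
  refine ⟨m, ⟨key _ _ ?_ ?_ ?_ ?_ ?_, key _ _ ?_ ?_ ?_ ?_ ?_⟩,
    fun i hi hi' => ⟨key _ _ ?_ ?_ ?_ ?_ ?_, key _ _ ?_ ?_ ?_ ?_ ?_⟩⟩ <;>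
  first
  | omega
  | (rw [h0 _ (by omega), h1 _ (by omega)]; omega)
  | (rw [h1 _ (by omega), h2 _ (by omega) (by omega)]; omega)

end Cycle

/-! ### Depth is bounded by the dimension at an associated prime -/

section AssociatedPrimes

open RingTheory.Sequence
open scoped Pointwise

variable {R : Type*} [CommRing R] [IsNoetherianRing R]

/-- For `M`-regular `x ∈ 𝔪`, an associated prime `P ≤ 𝔪` of `M` lies strictly below an associated
prime of `M / x M` in `𝔪`. It is found in the submodule `N` of elements killed by `P`: as `x` is
regular on `M / N`, the quotient `N / x N` embeds into `M / x M`. -/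
lemma exists_isAssociatedPrime_quotSMulTop {M : Type*} [AddCommGroup M] [Module R M]
    [Module.Finite R M] {P 𝔪 : Ideal R} [h𝔪 : 𝔪.IsPrime] (hP : IsAssociatedPrime P M)
    (hPm : P ≤ 𝔪) {x : R} (hx : x ∈ 𝔪) (hreg : IsSMulRegular M x) :
    ∃ Q, IsAssociatedPrime Q (QuotSMulTop x M) ∧ P < Q ∧ Q ≤ 𝔪 := by
  obtain ⟨hPp, z, hz⟩ := (isAssociatedPrime_iff).1 hP
  have hzP : ∀ r, r ∈ P ↔ r • z = 0 := by
    intro r; rw [hz, Submodule.mem_colon_singleton, Submodule.mem_bot]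
  let N : Submodule R M := Submodule.torsionBySet R M (P : Set R)
  have hzN : z ∈ N := (Submodule.mem_torsionBySet_iff _ _).2 fun r => (hzP r).1 r.2
  have hsupp : (⟨𝔪, h𝔪⟩ : PrimeSpectrum R) ∈ Module.support R (QuotSMulTop x N) := by
    rw [Module.support_quotSMulTop]
    refine ⟨Module.mem_support_iff_exists_annihilator.2 ⟨⟨z, hzN⟩, fun r hr => hPm ?_⟩, ?_⟩
    · rw [Submodule.mem_annihilator_span_singleton] at hr
      exact (hzP r).2 (congrArg Subtype.val hr)
    · simpa using hx
  have hann : Module.annihilator R (QuotSMulTop x N) ≤ 𝔪 :=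
    Module.annihilator_le_of_mem_support hsupp
  obtain ⟨Q, hQ, hQm⟩ := Ideal.exists_minimalPrimes_le hann
  have hQa : IsAssociatedPrime Q (QuotSMulTop x N) :=
    Module.associatedPrimes.minimalPrimes_annihilator_subset_associatedPrimes R _ hQ
  have hinj : Function.Injective (QuotSMulTop.map x N.subtype) := by
    rw [injective_iff_map_eq_zero]
    intro y hy
    obtain ⟨y, rfl⟩ := Submodule.Quotient.mk_surjective _ y
    have hy' : (y : M) ∈ x • (⊤ : Submodule R M) := (Submodule.Quotient.mk_eq_zero _).1 hy
    obtain ⟨w, -, hw⟩ := hy'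
    -- `w` is again annihilated by `P`, because `x` is regular
    have hwN : w ∈ N := by
      refine (Submodule.mem_torsionBySet_iff _ _).2 fun r => hreg ?_
      have h1 : r • (y : M) = 0 := (Submodule.mem_torsionBySet_iff _ _).1 y.2 r
      have h2 : x • w = (y : M) := hw
      change x • ((r : R) • w) = x • (0 : M)
      rw [smul_comm, h2, smul_zero]
      exact h1
    refine (Submodule.Quotient.mk_eq_zero _).2 ⟨⟨w, hwN⟩, trivial, Subtype.ext hw⟩
  have hle : Module.annihilator R (QuotSMulTop x N) ≤ Q := hQ.1.2
  refine ⟨Q, IsAssociatedPrime.map_of_injective _ hQa hinj, lt_of_le_of_ne ?_ ?_, hQm⟩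
  · intro r hr
    refine hle (Module.mem_annihilator.2 fun y => ?_)
    obtain ⟨y, rfl⟩ := Submodule.Quotient.mk_surjective _ y
    have : r • y = 0 := Subtype.ext ((Submodule.mem_torsionBySet_iff _ _).1 y.2 ⟨r, hr⟩)
    rw [← Submodule.Quotient.mk_smul, this, Submodule.Quotient.mk_zero]
  · rintro rfl
    have hxQ : x ∈ P := by
      refine hle (Module.mem_annihilator.2 fun y => ?_)
      obtain ⟨y, rfl⟩ := Submodule.Quotient.mk_surjective _ y
      rw [← Submodule.Quotient.mk_smul, Submodule.Quotient.mk_eq_zero]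
      exact ⟨y, trivial, rfl⟩
    have hz0 : z = 0 := hreg (by simpa using (hzP x).1 hxQ)
    exact hPp.ne_top ((Ideal.eq_top_iff_one P).2 ((hzP 1).2 (by rw [hz0, smul_zero])))

/-- A regular sequence in a prime `𝔪` is no longer than the chains of primes above an associated
prime contained in `𝔪`: each element lifts an associated prime to a strictly larger one. -/
lemma length_le_coheight {𝔪 : Ideal R} [𝔪.IsPrime] (rs : List R) :
    ∀ {M : Type*} [AddCommGroup M] [Module R M] [Module.Finite R M] {P : Ideal R}
      (hP : IsAssociatedPrime P M), P ≤ 𝔪 → (∀ r ∈ rs, r ∈ 𝔪) → IsWeaklyRegular M rs →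
      (rs.length : ℕ∞) ≤ Order.coheight (⟨P, hP.isPrime⟩ : PrimeSpectrum R) := by
  induction rs with
  | nil => intros; simp
  | cons x rs ih =>
    intro M _ _ _ P hP hPm hmem hreg
    rw [isWeaklyRegular_cons_iff] at hreg
    obtain ⟨Q, hQ, hPQ, hQm⟩ :=
      exists_isAssociatedPrime_quotSMulTop hP hPm (hmem x (by simp)) hreg.1
    have h1 := ih hQ hQm (fun r hr => hmem r (by simp [hr])) hreg.2
    have h2 : (⟨P, hP.isPrime⟩ : PrimeSpectrum R) < ⟨Q, hQ.isPrime⟩ := hPQ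
    calc ((x :: rs).length : ℕ∞) = rs.length + 1 := by simp
      _ ≤ Order.coheight (⟨Q, hQ.isPrime⟩ : PrimeSpectrum R) + 1 := by gcongr
      _ ≤ _ := Order.coheight_add_one_le h2

omit [IsNoetherianRing R] in
lemma coheight_le_ringKrullDim_quotient (P : Ideal R) [hP : P.IsPrime] :
    (Order.coheight (⟨P, hP⟩ : PrimeSpectrum R) : WithBot ℕ∞) ≤ ringKrullDim (R ⧸ P) := by
  have : PrimeSpectrum.zeroLocus (P : Set R) = Set.Ici (⟨P, hP⟩ : PrimeSpectrum R) := by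
    ext q; rfl
  rw [ringKrullDim_quotient, this, Order.coheight_eq_krullDim_Ici]

/-- The depth of `M` is at most the dimension of `R ⧸ P` for an associated prime `P`. -/
lemma depth_le_ringKrullDim_quotient {𝔪 : Ideal R} [𝔪.IsPrime] {M : Type*} [AddCommGroup M]
    [Module R M] [Module.Finite R M] {P : Ideal R} (hP : IsAssociatedPrime P M) (hPm : P ≤ 𝔪) :
    (depth 𝔪 M : WithBot ℕ∞) ≤ ringKrullDim (R ⧸ P) := by
  have := hP.isPrime
  refine le_trans (WithBot.coe_le_coe.2 ?_) (coheight_le_ringKrullDim_quotient P)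
  exact iSup₂_le fun rs hrs => length_le_coheight rs hP hPm hrs.1 hrs.2.toIsWeaklyRegular

end AssociatedPrimes

/-! ### Independent dominating sets bound the depth of an edge ideal -/

section UpperBound

variable {V : Type*} {k : Type*} [Field k]

lemma monomial_mul_mem_monomialIdeal {U : Set (V →₀ ℕ)} (hU : IsUpperSet U) (w : V →₀ ℕ)
    {r : MvPolynomial V k} :
    monomial w 1 * r ∈ monomialIdeal k U ↔ r ∈ monomialIdeal k {t | w + t ∈ U} := by
  have hU' : IsUpperSet {t | w + t ∈ U} := fun s t hst hs => hU (by gcongr) hs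
  rw [mem_monomialIdeal hU, mem_monomialIdeal hU']
  constructor
  · intro h t ht
    refine h _ (mem_support_iff.2 ?_)
    rw [coeff_monomial_mul, one_mul]
    exact mem_support_iff.1 ht
  · intro h s hs
    rw [mem_support_iff, coeff_monomial_mul'] at hs
    split_ifs at hs with hws
    · have := h (s - w) (mem_support_iff.2 (by simpa using hs))
      rwa [Set.mem_ofPred_eq, add_tsub_cancel_of_le hws] at this
    · exact absurd rfl hs

lemma span_X_image_eq_monomialIdeal (K : Set V) :
    Ideal.span (X '' K) = monomialIdeal k {t : V →₀ ℕ | ∃ v ∈ K, 1 ≤ t v} := by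
  ext p
  have hU : IsUpperSet {t : V →₀ ℕ | ∃ v ∈ K, 1 ≤ t v} :=
    fun s t hst ⟨v, hv, h⟩ => ⟨v, hv, h.trans (hst v)⟩
  rw [mem_ideal_span_X_image, mem_monomialIdeal hU]
  simp only [Set.mem_ofPred_eq, Nat.one_le_iff_ne_zero]

lemma ker_killCompl (D : Set V) :
    RingHom.ker (killCompl (R := k) (Subtype.val_injective (p := (· ∈ D)))) =
      Ideal.span (X '' Dᶜ) := by
  set φ := killCompl (R := k) (Subtype.val_injective (p := (· ∈ D))) with hφ
  have hX : ∀ v ∉ D, φ (X v) = 0 := by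
    intro v hv
    rw [hφ, killCompl, aeval_X, dif_neg]
    rintro ⟨⟨w, hw⟩, rfl⟩
    exact hv hw
  apply le_antisymm
  · intro p hp
    have key : ∀ q : MvPolynomial V k,
        q - rename Subtype.val (φ q) ∈ Ideal.span (X '' Dᶜ : Set (MvPolynomial V k)) := by
      intro q
      induction q using MvPolynomial.induction_on with
      | C a => simp [hφ]
      | add p q hp hq =>
        have := Ideal.add_mem _ hp hq
        rw [map_add, map_add]
        convert this using 1
        ring
      | mul_X p v hp =>
        rw [map_mul, map_mul]
        by_cases hv : v ∈ D
        · have h1 : rename Subtype.val (φ (X v)) = (X v : MvPolynomial V k) := by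
            have : (X v : MvPolynomial V k) = rename Subtype.val (X (⟨v, hv⟩ : D)) := by
              rw [rename_X]
            rw [this, hφ, killCompl_rename_app]
          rw [h1, ← sub_mul]
          exact Ideal.mul_mem_right _ _ hp
        · rw [hX v hv, map_zero, mul_zero, sub_zero]
          exact Ideal.mul_mem_left _ _ (Ideal.subset_span ⟨v, hv, rfl⟩)
    have := key p
    rwa [RingHom.mem_ker.1 hp, map_zero, sub_zero] at this
  · refine Ideal.span_le.2 ?_
    rintro _ ⟨v, hv, rfl⟩
    exact hX v hv

lemma isPrime_span_X_image (K : Set V) :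
    (Ideal.span (X '' K) : Ideal (MvPolynomial V k)).IsPrime := by
  rw [← compl_compl K, ← ker_killCompl]
  exact RingHom.ker_isPrime _

lemma ringKrullDim_quotient_span_X_image (D : Set V) [Finite D] :
    ringKrullDim (MvPolynomial V k ⧸ (Ideal.span (X '' Dᶜ) : Ideal (MvPolynomial V k)))
      = Nat.card D := by
  rw [← ker_killCompl]
  have hsurj : Function.Surjective (killCompl (R := k) (Subtype.val_injective (p := (· ∈ D)))) :=
    fun p => ⟨_, killCompl_rename_app _ p⟩
  rw [ringKrullDim_eq_of_ringEquiv (Ideal.quotientKerAlgEquivOfSurjective hsurj).toRingEquiv,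
    MvPolynomial.ringKrullDim_of_isNoetherianRing, ringKrullDim_eq_zero_of_field, zero_add]

/-- An independent dominating set `D` bounds the depth: the complementary variables generate
an associated prime of the edge ideal. -/
lemma depth_le_card_of_dominating [Finite V] (G : SimpleGraph V) (D : Finset V)
    (hind : ∀ p ∈ D, ∀ q ∈ D, ¬ G.Adj p q) (hdom : ∀ v ∉ D, ∃ d ∈ D, G.Adj v d) :
    depth (Ideal.span (Set.range (X : V → MvPolynomial V k)))
      (MvPolynomial V k ⧸ edgeIdeal k G) ≤ D.card := by
  classical
  have hU := isUpperSet_edgeExponents G ∅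
  let w : V →₀ ℕ := ∑ d ∈ D, Finsupp.single d 1
  have hw : ∀ v, w v = if v ∈ D then 1 else 0 := by
    intro v
    simp [w, Finsupp.finsetSum_apply, Finsupp.single_apply]
  have hset : {t | w + t ∈ edgeExponents G ∅} = {t : V →₀ ℕ | ∃ v ∈ (D : Set V)ᶜ, 1 ≤ t v} := by
    ext t
    constructor
    · rintro (⟨v, hv, -⟩ | ⟨p, q, hpq, hp, hq⟩)
      · exact absurd hv (Set.notMem_empty v)
      · rw [Finsupp.add_apply, hw] at hp hq
        by_cases hpD : p ∈ D
        · have hqD : q ∉ D := fun h => hind p hpD q h hpq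
          rw [if_neg hqD, zero_add] at hq
          exact ⟨q, hqD, hq⟩
        · rw [if_neg hpD, zero_add] at hp
          exact ⟨p, hpD, hp⟩
    · rintro ⟨v, hv, h⟩
      obtain ⟨d, hd, hvd⟩ := hdom v hv
      refine Or.inr ⟨v, d, hvd, ?_, ?_⟩
      · rw [Finsupp.add_apply]; omega
      · rw [Finsupp.add_apply, hw, if_pos hd]; omega
  have hP : IsAssociatedPrime (Ideal.span (X '' (D : Set V)ᶜ) : Ideal (MvPolynomial V k))
      (MvPolynomial V k ⧸ edgeIdeal k G) := by
    refine (isAssociatedPrime_iff).2 ⟨isPrime_span_X_image _,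
      Ideal.Quotient.mk _ (monomial w 1), ?_⟩
    ext r
    rw [Submodule.mem_colon_singleton, Submodule.mem_bot, span_X_image_eq_monomialIdeal, ← hset,
      ← monomial_mul_mem_monomialIdeal hU, ← edgeIdeal_eq_monomialIdeal, mul_comm,
      ← Ideal.Quotient.eq_zero_iff_mem, map_mul]
    rfl
  have hm : (Ideal.span (Set.range (X : V → MvPolynomial V k))).IsPrime := by
    rw [← Set.image_univ]; exact isPrime_span_X_image _
  have := depth_le_ringKrullDim_quotient hP
    (Ideal.span_mono (Set.image_subset_range X (D : Set V)ᶜ))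
  rw [ringKrullDim_quotient_span_X_image] at this
  have h2 : Nat.card (D : Set V) = D.card := by simp
  rw [h2] at this
  exact_mod_cast this

end UpperBound

/-! ### Depth through the vanishing of `Ext` -/

section Ext

open CategoryTheory Abelian RingTheory.Sequence
open scoped Pointwise

universe u

variable {R : Type u} [CommRing R]

/-- The vanishing of `Ext^i(R ⧸ J, R ⧸ I)` for `i < n`, which by Rees' theorem expresses that
`J` contains an `R ⧸ I`-regular sequence of length `n`. -/
def ExtVanish (J I : Ideal R) (n : ℕ) : Prop :=
  ∀ i < n, Subsingleton (Ext (ModuleCat.of R (Shrink.{u} (R ⧸ J))) (ModuleCat.of R (R ⧸ I)) i)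

lemma ExtVanish.mono {J I : Ideal R} {n n' : ℕ} (h : ExtVanish J I n) (hn : n' ≤ n) :
    ExtVanish J I n' := fun i hi => h i (hi.trans_le hn)

lemma extVanish_iff [IsNoetherianRing R] {J I : Ideal R} (hIJ : I ≤ J) (hJ : J ≠ ⊤) {n : ℕ} :
    ExtVanish J I n ↔
      ∃ rs : List R, rs.length = n ∧ (∀ r ∈ rs, r ∈ J) ∧ IsRegular (R ⧸ I) rs := by
  refine (ModuleCat.exists_isRegular_tfae J n (ModuleCat.of R (R ⧸ I)) ?_).out 1 3
  refine lt_top_iff_ne_top.2 fun h => hJ ?_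
  rw [Ideal.eq_top_iff_one]
  have h1 : (Ideal.Quotient.mk I 1) ∈ J • (⊤ : Submodule R (R ⧸ I)) := by
    have h' : J • (⊤ : Submodule R (R ⧸ I)) = ⊤ := h
    rw [h']
    trivial
  have hle : J • (⊤ : Submodule R (R ⧸ I)) ≤ Submodule.map I.mkQ J := by
    refine Submodule.smul_le.2 fun r hr y _ => ?_
    obtain ⟨y, rfl⟩ := Ideal.Quotient.mk_surjective y
    exact ⟨r * y, J.mul_mem_right _ hr, rfl⟩
  obtain ⟨r, hr, hr1⟩ := hle h1
  have : r - 1 ∈ I := Ideal.Quotient.eq.1 hr1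
  have := J.sub_mem hr (hIJ this)
  simpa using this

/-- Depth along the short exact sequence `R ⧸ (I : x) → R ⧸ I → R ⧸ (I + (x))`. -/
lemma ExtVanish.of_colon_of_sup {J I I₁ : Ideal R} {x : R} (hI₁ : ∀ r, r ∈ I₁ ↔ x * r ∈ I)
    {n : ℕ} (h₁ : ExtVanish J I₁ n) (h₂ : ExtVanish J (I ⊔ Ideal.span {x}) n) :
    ExtVanish J I n := by
  let f : (R ⧸ I₁) →ₗ[R] (R ⧸ I) :=
    Submodule.mapQ I₁ I (LinearMap.mulLeft R x) fun r hr => (hI₁ r).1 hr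
  let g : (R ⧸ I) →ₗ[R] (R ⧸ I ⊔ Ideal.span {x}) :=
    Submodule.mapQ I (I ⊔ Ideal.span {x}) LinearMap.id fun r hr => Ideal.mem_sup_left hr
  have hf : ∀ r : R, f (Ideal.Quotient.mk I₁ r) = Ideal.Quotient.mk I (x * r) := fun _ => rfl
  have hg : ∀ r : R, g (Ideal.Quotient.mk I r) = Ideal.Quotient.mk _ r := fun _ => rfl
  have hinj : Function.Injective f := by
    rw [injective_iff_map_eq_zero]
    intro y hy
    obtain ⟨y, rfl⟩ := Ideal.Quotient.mk_surjective y
    rw [hf, Ideal.Quotient.eq_zero_iff_mem] at hy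
    exact Ideal.Quotient.eq_zero_iff_mem.2 ((hI₁ y).2 hy)
  have hsurj : Function.Surjective g := by
    intro y
    obtain ⟨y, rfl⟩ := Ideal.Quotient.mk_surjective y
    exact ⟨_, hg y⟩
  have hexact : Function.Exact f g := by
    intro y
    obtain ⟨y, rfl⟩ := Ideal.Quotient.mk_surjective y
    rw [hg, Ideal.Quotient.eq_zero_iff_mem]
    constructor
    · intro hy
      obtain ⟨a, ha, b, hb, rfl⟩ := Submodule.mem_sup.1 hy
      obtain ⟨c, rfl⟩ := Ideal.mem_span_singleton'.1 hb
      refine ⟨Ideal.Quotient.mk _ c, ?_⟩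
      rw [hf, Ideal.Quotient.eq, mul_comm]
      simpa using ha
    · rintro ⟨c, hc⟩
      obtain ⟨c, rfl⟩ := Ideal.Quotient.mk_surjective c
      rw [hf, Ideal.Quotient.eq] at hc
      have h1 : x * c ∈ I ⊔ Ideal.span {x} :=
        Ideal.mem_sup_right (Ideal.mul_mem_right _ _ (Ideal.subset_span rfl))
      have := Ideal.sub_mem _ h1 (Ideal.mem_sup_left hc)
      simpa using this
  let S : ShortComplex (ModuleCat.{u} R) :=
    ShortComplex.mk (ModuleCat.ofHom f) (ModuleCat.ofHom g) (by
      rw [← ModuleCat.ofHom_comp, hexact.linearMap_comp_eq_zero]; rfl)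
  have hS : S.ShortExact :=
    { exact := (ShortComplex.ShortExact.moduleCat_exact_iff_function_exact S).2 hexact
      mono_f := (ModuleCat.mono_iff_injective _).2 hinj
      epi_g := (ModuleCat.epi_iff_surjective _).2 hsurj }
  intro i hi
  have hs₁ : Subsingleton (Ext (ModuleCat.of R (Shrink.{u} (R ⧸ J))) S.X₁ i) := h₁ i hi
  have hs₂ : Subsingleton (Ext (ModuleCat.of R (Shrink.{u} (R ⧸ J))) S.X₃ i) := h₂ i hi
  refine subsingleton_of_forall_eq 0 fun e => ?_
  obtain ⟨e₁, rfl⟩ := Ext.covariant_sequence_exact₂ _ hS (show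
    Ext (ModuleCat.of R (Shrink.{u} (R ⧸ J))) S.X₂ i from e) (Subsingleton.elim _ _)
  rw [Subsingleton.elim e₁ 0, Ext.zero_comp]

lemma exists_isRegular_cons {J I : Ideal R} {x : R} (hxJ : x ∈ J)
    (hx : IsSMulRegular (R ⧸ I) x) {n : ℕ}
    (h : ∃ rs : List R, rs.length = n ∧ (∀ r ∈ rs, r ∈ J) ∧
      IsRegular (R ⧸ I ⊔ Ideal.span {x}) rs) :
    ∃ rs : List R, rs.length = n + 1 ∧ (∀ r ∈ rs, r ∈ J) ∧ IsRegular (R ⧸ I) rs := by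
  obtain ⟨rs, hlen, hmem, hreg⟩ := h
  have hmap : x • (⊤ : Submodule R (R ⧸ I)) = Submodule.map I.mkQ (Ideal.span {x}) := by
    rw [← Submodule.ideal_span_singleton_smul]
    apply le_antisymm
    · refine Submodule.smul_le.2 fun r hr y _ => ?_
      obtain ⟨y, rfl⟩ := Ideal.Quotient.mk_surjective y
      exact ⟨r * y, Ideal.mul_mem_right _ _ hr, rfl⟩
    · rintro _ ⟨r, hr, rfl⟩
      have : I.mkQ r = r • (Ideal.Quotient.mk I 1) := by
        rw [← Ideal.Quotient.mk_eq_mk, ← Submodule.Quotient.mk_smul, smul_eq_mul, mul_one]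
        rfl
      rw [this]
      exact Submodule.smul_mem_smul hr trivial
  let e : QuotSMulTop x (R ⧸ I) ≃ₗ[R] R ⧸ I ⊔ Ideal.span {x} :=
    Submodule.quotEquivOfEq _ _ hmap ≪≫ₗ Submodule.quotientQuotientEquivQuotientSup _ _
  refine ⟨x :: rs, by simp [hlen], by simpa [hxJ] using hmem, IsRegular.cons hx ?_⟩
  exact (e.isRegular_congr rs).2 hreg

end Ext

/-! ### Splitting off a vertex of an edge ideal -/

section LowerBound

variable {V : Type*} {k : Type*} [Field k] (G : SimpleGraph V)

lemma monomialIdeal_edgeExponents_le (K : Set V) :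
    monomialIdeal k (edgeExponents G K) ≤ Ideal.span (Set.range X) := by
  rw [← Set.image_univ, span_X_image_eq_monomialIdeal]
  refine Ideal.span_mono (Set.image_mono ?_)
  rintro t (⟨v, -, h⟩ | ⟨p, -, -, h, -⟩)
  · exact ⟨v, trivial, h⟩
  · exact ⟨p, trivial, h⟩

lemma span_range_X_ne_top : Ideal.span (Set.range (X : V → MvPolynomial V k)) ≠ ⊤ := by
  rw [← Set.image_univ]
  exact (isPrime_span_X_image _).ne_top

lemma sup_span_X (K : Set V) (p : V) :
    monomialIdeal k (edgeExponents G K) ⊔ Ideal.span {X p}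
      = monomialIdeal k (edgeExponents G (insert p K)) := by
  apply le_antisymm
  · refine sup_le (Ideal.span_mono (Set.image_mono ?_)) ?_
    · rintro t (⟨v, hv, h⟩ | h)
      · exact Or.inl ⟨v, Or.inr hv, h⟩
      · exact Or.inr h
    · rw [Ideal.span_singleton_le_iff_mem, X]
      exact monomial_mem_monomialIdeal (Or.inl ⟨p, Or.inl rfl, by simp⟩) 1
  · refine Ideal.span_le.2 ?_
    have key : ∀ t ∈ edgeExponents G K, monomial t (1 : k) ∈
        monomialIdeal k (edgeExponents G K) ⊔ Ideal.span {X p} := fun t ht =>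
      Ideal.mem_sup_left (monomial_mem_monomialIdeal ht 1)
    rintro _ ⟨t, (⟨v, rfl | hv, h⟩ | h), rfl⟩
    · refine Ideal.mem_sup_right (Ideal.mem_span_singleton.2 ?_)
      rw [X, monomial_dvd_monomial]
      exact ⟨Or.inr (Finsupp.single_le_iff.2 h), one_dvd 1⟩
    · exact key t (Or.inl ⟨v, hv, h⟩)
    · exact key t (Or.inr h)

/-- The colon ideal by a variable `p`: the neighbours of `p` are added to the variables. -/
lemma colon_X {K : Set V} {p : V} (hp : p ∉ K) (r : MvPolynomial V k) :
    r ∈ monomialIdeal k (edgeExponents G (K ∪ G.neighborSet p)) ↔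
      X p * r ∈ monomialIdeal k (edgeExponents G K) := by
  rw [X, monomial_mul_mem_monomialIdeal (isUpperSet_edgeExponents G K)]
  have : edgeExponents G (K ∪ G.neighborSet p)
      = {t | Finsupp.single p 1 + t ∈ edgeExponents G K} := by
    have hne : ∀ (t : V →₀ ℕ) (v : V), v ≠ p → (Finsupp.single p 1 + t : V →₀ ℕ) v = t v :=
      fun t v hv => by simp [Finsupp.single_eq_of_ne hv]
    have hle : ∀ (t : V →₀ ℕ) (v : V), t v ≤ (Finsupp.single p 1 + t : V →₀ ℕ) v :=
      fun t v => by simp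
    have heq : ∀ (t : V →₀ ℕ), 1 ≤ (Finsupp.single p 1 + t : V →₀ ℕ) p := fun t => by simp
    ext t
    constructor
    · rintro (⟨v, hv | hv, h⟩ | ⟨a, b, hab, ha, hb⟩)
      · exact Or.inl ⟨v, hv, h.trans (hle t v)⟩
      · exact Or.inr ⟨p, v, hv, heq t, h.trans (hle t v)⟩
      · exact Or.inr ⟨a, b, hab, ha.trans (hle t a), hb.trans (hle t b)⟩
    · rintro (⟨v, hv, h⟩ | ⟨a, b, hab, ha, hb⟩)
      · refine Or.inl ⟨v, Or.inl hv, ?_⟩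
        rwa [hne t v (fun h => hp (h ▸ hv))] at h
      · by_cases hap : a = p
        · subst hap
          rw [hne t b hab.ne'] at hb
          exact Or.inl ⟨b, Or.inr hab, hb⟩
        by_cases hbp : b = p
        · subst hbp
          rw [hne t a hab.ne] at ha
          exact Or.inl ⟨a, Or.inr hab.symm, ha⟩
        · rw [hne t a hap] at ha
          rw [hne t b hbp] at hb
          exact Or.inr ⟨a, b, hab, ha, hb⟩
  rw [this]

/-- The variables outside a set form a regular sequence modulo the variables in the set. -/
lemma exists_isRegular_bot [Finite V] (F : Finset V) :
    ∃ rs : List (MvPolynomial V k), rs.length = F.card ∧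
      (∀ r ∈ rs, r ∈ Ideal.span (Set.range X)) ∧ RingTheory.Sequence.IsRegular
        (MvPolynomial V k ⧸ monomialIdeal k (edgeExponents (⊥ : SimpleGraph V) (F : Set V)ᶜ))
        rs := by
  classical
  induction F using Finset.induction_on with
  | empty =>
    have hne : monomialIdeal k (edgeExponents (⊥ : SimpleGraph V) ((∅ : Finset V) : Set V)ᶜ) ≠ ⊤ :=
      fun h => span_range_X_ne_top (k := k) (V := V)
        (top_le_iff.1 (h ▸ monomialIdeal_edgeExponents_le ⊥ _))
    have := Ideal.Quotient.nontrivial_iff.2 hne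
    exact ⟨[], by simp, by simp, RingTheory.Sequence.IsRegular.nil _ _⟩
  | insert p F hp ih =>
    rw [Finset.card_insert_of_notMem hp]
    have hpK : p ∉ ((insert p F : Finset V) : Set V)ᶜ := by simp
    refine exists_isRegular_cons (x := X p) (Ideal.subset_span (Set.mem_range_self p)) ?_ ?_
    · rw [isSMulRegular_iff_right_eq_zero_of_smul]
      intro y hy
      obtain ⟨y, rfl⟩ := Ideal.Quotient.mk_surjective y
      have hy' := Ideal.Quotient.eq_zero_iff_mem.1
        (show Ideal.Quotient.mk _ (X p * y) = 0 from hy)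
      rw [← colon_X ⊥ hpK] at hy'
      refine Ideal.Quotient.eq_zero_iff_mem.2 ?_
      convert hy' using 3
      ext v
      simp
    · rw [sup_span_X]
      have : insert p ((insert p F : Finset V) : Set V)ᶜ = (F : Set V)ᶜ := by
        ext v
        by_cases hv : v = p
        · subst hv; simp [hp]
        · simp [hv]
      rw [this]
      exact ih

variable {G}

lemma extVanish_of_independent [Finite V] {K : Set V} {F : Finset V} (hF : ∀ v, v ∉ K ↔ v ∈ F)
    (hind : ∀ p ∈ F, ∀ q ∈ F, ¬ G.Adj p q) :
    ExtVanish (Ideal.span (Set.range X)) (monomialIdeal k (edgeExponents G K)) F.card := by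
  have h1 : edgeExponents G K = edgeExponents ⊥ (F : Set V)ᶜ := by
    have hK : K = (F : Set V)ᶜ := by
      ext v
      have := hF v
      simp only [Set.mem_compl_iff, Finset.mem_coe]
      tauto
    ext t
    constructor
    · rintro (⟨v, hv, h⟩ | ⟨p, q, hpq, hp, hq⟩)
      · exact Or.inl ⟨v, hK ▸ hv, h⟩
      · by_cases h1 : p ∈ F
        · exact Or.inl ⟨q, fun h2 => hind p h1 q h2 hpq, hq⟩
        · exact Or.inl ⟨p, h1, hp⟩
    · rintro (⟨v, hv, h⟩ | ⟨p, q, hpq, -⟩)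
      · exact Or.inl ⟨v, hK ▸ hv, h⟩
      · exact absurd hpq (by simp)
  rw [h1, extVanish_iff (monomialIdeal_edgeExponents_le ⊥ _) span_range_X_ne_top]
  exact exists_isRegular_bot F

/-- Reduction of the depth of `R ⧸ (edges + variables in K)` to the two cases where a further
variable `p` is inverted (its neighbours are killed) or killed. -/
lemma extVanish_of_split {K : Set V} {p : V} (hp : p ∉ K) {d : ℕ}
    (h₁ : ExtVanish (Ideal.span (Set.range X))
      (monomialIdeal k (edgeExponents G (K ∪ G.neighborSet p))) d)
    (h₂ : ExtVanish (Ideal.span (Set.range X))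
      (monomialIdeal k (edgeExponents G (insert p K))) d) :
    ExtVanish (Ideal.span (Set.range X)) (monomialIdeal k (edgeExponents G K)) d :=
  ExtVanish.of_colon_of_sup (colon_X G hp) h₁ (by rwa [sup_span_X])

end LowerBound

/-! ### The depth of the cycle -/

section Cycle

variable {n : ℕ} {k : Type*} [Field k]

/-- If the vertices outside `K` are a path `j, …, e - 1` with `ℓ = e - j` vertices and a set `F` of
isolated vertices, then the depth is at least `|F| + ⌈ℓ / 3⌉`. -/
lemma extVanish_path (ℓ : ℕ) : ∀ (j e : ℕ) (K : Set (Fin (3 * n + 2)))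
    (F : Finset (Fin (3 * n + 2))), e - j = ℓ → (1 ≤ j ∨ e < 3 * n + 2) →
    (∀ v, v ∉ K ↔ v ∈ F ∨ (j ≤ v.val ∧ v.val < e)) →
    (∀ v ∈ F, ¬ (j ≤ v.val ∧ v.val < e)) →
    (∀ v ∈ F, ∀ q ∉ K, ¬ (SimpleGraph.cycleGraph (3 * n + 2)).Adj v q) →
    e ≤ 3 * n + 2 →
    ExtVanish (Ideal.span (Set.range X))
      (monomialIdeal k (edgeExponents (SimpleGraph.cycleGraph (3 * n + 2)) K))
      (F.card + (ℓ + 2) / 3) := by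
  induction ℓ using Nat.strong_induction_on with
  | _ ℓ ih =>
  intro j e K F hℓ hwrap hK hFd hF he
  have hadj : ∀ {u v : Fin (3 * n + 2)}, (SimpleGraph.cycleGraph (3 * n + 2)).Adj u v ↔ _ :=
    fun {u v} => cycle_adj
  rcases Nat.lt_or_ge ℓ 1 with h0 | h1
  · have hK' : ∀ v, v ∉ K ↔ v ∈ F := by
      intro v
      rw [hK v]
      constructor
      · rintro (h | h)
        · exact h
        · omega
      · exact Or.inl
    refine (extVanish_of_independent hK' fun p hp q hq => hF p hp q ((hK' q).2 hq)).mono ?_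
    omega
  have hjN : j < 3 * n + 2 := by omega
  let vj : Fin (3 * n + 2) := ⟨j, hjN⟩
  have hvj : vj ∉ F := fun h => hFd vj h ⟨le_rfl, by change j < e; omega⟩
  have hvjK : vj ∉ K := (hK vj).2 (Or.inr ⟨le_rfl, by change j < e; omega⟩)
  -- the first vertex of the path becomes isolated once the second one is killed
  have isol : ∀ K' : Set (Fin (3 * n + 2)), (∀ v, v ∉ K' → v ∉ K) →
      (∀ v : Fin (3 * n + 2), v.val = j + 1 → v ∈ K') →
        ∀ q ∉ K', ¬ (SimpleGraph.cycleGraph (3 * n + 2)).Adj vj q := by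
    intro K' hKK' hj1 q hq hvq
    rcases (hK q).1 (hKK' q hq) with hqF | hqP
    · exact hF q hqF vj hvjK hvq.symm
    · have hqv : q.val ≠ j + 1 := fun h => hq (hj1 q h)
      rw [hadj] at hvq
      change j + 1 = q.val ∨ q.val + 1 = j ∨ (j = 0 ∧ q.val = 3 * n + 1) ∨
        (q.val = 0 ∧ j = 3 * n + 1) at hvq
      omega
  rcases Nat.lt_or_ge ℓ 2 with h2 | h2
  · -- a path with one vertex
    have hℓ1 : ℓ = 1 := by omega
    have := ih 0 (by omega) (j + 1) e K (insert vj F) (by omega) (Or.inl (by omega)) ?_ ?_ ?_ he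
    · rw [Finset.card_insert_of_notMem hvj] at this
      exact this.mono (by omega)
    · intro v
      rw [hK v, Finset.mem_insert, Fin.ext_iff]
      change _ ↔ (v.val = j ∨ v ∈ F) ∨ _
      constructor
      · rintro (h | h)
        · exact Or.inl (Or.inr h)
        · left; left; omega
      · rintro ((h | h) | h)
        · right; omega
        · exact Or.inl h
        · omega
    · intro v hv; omega
    · intro v hv q hq
      rcases Finset.mem_insert.1 hv with rfl | hv
      · refine isol K (fun _ h => h) (fun v hv => ?_) q hq
        by_contra h
        rcases (hK v).1 h with h' | h'
        · refine hF v h' vj hvjK (hadj.2 ?_)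
          right; left; exact hv.symm
        · omega
      · exact hF v hv q hq
  -- split at the second vertex of the path
  let p : Fin (3 * n + 2) := ⟨j + 1, by omega⟩
  have hpv : p.val = j + 1 := rfl
  have hpF : p ∉ F := fun h => hFd p h ⟨by omega, by omega⟩
  have hpK : p ∉ K := (hK p).2 (Or.inr ⟨by omega, by omega⟩)
  have hnb : ∀ v : Fin (3 * n + 2), (j ≤ v.val ∧ v.val < e) →
      ((SimpleGraph.cycleGraph (3 * n + 2)).Adj p v ↔ v.val = j ∨ v.val = j + 2) := by
    intro v hv
    rw [hadj, hpv]
    omega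
  refine extVanish_of_split hpK ?_ ?_
  · have := ih (ℓ - 3) (by omega) (j + 3) e
      (K ∪ (SimpleGraph.cycleGraph (3 * n + 2)).neighborSet p) (insert p F) (by omega)
      (Or.inl (by omega)) ?_ ?_ ?_ he
    · rw [Finset.card_insert_of_notMem hpF] at this
      exact this.mono (by omega)
    · intro v
      rw [Set.mem_union, not_or, hK v, SimpleGraph.mem_neighborSet, Finset.mem_insert]
      constructor
      · rintro ⟨h | h, hpv'⟩
        · exact Or.inl (Or.inr h)
        · rw [hnb v h] at hpv'
          by_cases hvp : v = p
          · exact Or.inl (Or.inl hvp)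
          · have : v.val ≠ j + 1 := fun h' => hvp (Fin.ext h')
            right; omega
      · rintro ((rfl | h) | h)
        · exact ⟨Or.inr ⟨by omega, by omega⟩, SimpleGraph.irrefl _⟩
        · exact ⟨Or.inl h, fun h' => hF v h p hpK h'.symm⟩
        · refine ⟨Or.inr ⟨by omega, h.2⟩, ?_⟩
          rw [hnb v ⟨by omega, h.2⟩]
          omega
    · intro v hv
      rcases Finset.mem_insert.1 hv with rfl | hv
      · omega
      · have := hFd v hv
        omega
    · intro v hv q hq
      rw [Set.mem_union, not_or] at hq
      rcases Finset.mem_insert.1 hv with rfl | hv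
      · exact hq.2
      · exact hF v hv q hq.1
  · have := ih (ℓ - 2) (by omega) (j + 2) e (insert p K) (insert vj F) (by omega)
      (Or.inl (by omega)) ?_ ?_ ?_ he
    · rw [Finset.card_insert_of_notMem hvj] at this
      exact this.mono (by omega)
    · intro v
      rw [Set.mem_insert_iff, not_or, hK v, Finset.mem_insert, Fin.ext_iff, Fin.ext_iff, hpv]
      change _ ↔ (v.val = j ∨ v ∈ F) ∨ _
      constructor
      · rintro ⟨h1, h | h⟩
        · exact Or.inl (Or.inr h)
        · by_cases hv : v.val = j
          · exact Or.inl (Or.inl hv)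
          · right; omega
      · rintro ((h | h) | h)
        · exact ⟨by omega, Or.inr ⟨by omega, by omega⟩⟩
        · refine ⟨fun h' => hpF ?_, Or.inl h⟩
          have : v = p := Fin.ext h'
          rwa [← this]
        · exact ⟨by omega, Or.inr ⟨by omega, by omega⟩⟩
    · intro v hv
      rcases Finset.mem_insert.1 hv with rfl | hv
      · change ¬ (j + 2 ≤ j ∧ _)
        omega
      · have := hFd v hv
        omega
    · intro v hv q hq
      have hqK : q ∉ K := fun h => hq (Or.inr h)
      rcases Finset.mem_insert.1 hv with rfl | hv
      · exact isol (insert p K) (fun v h h' => h (Or.inr h'))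
          (fun v hv => Or.inl (Fin.ext hv)) q hq
      · exact hF v hv q hqK

lemma extVanish_cycle (hn : 1 ≤ n) :
    ExtVanish (Ideal.span (Set.range X)) (edgeIdeal k (SimpleGraph.cycleGraph (3 * n + 2)))
      (n + 1) := by
  rw [edgeIdeal_eq_monomialIdeal]
  let p : Fin (3 * n + 2) := ⟨0, by omega⟩
  have hpv : p.val = 0 := rfl
  refine extVanish_of_split (p := p) (Set.notMem_empty _) ?_ ?_
  · have := extVanish_path (k := k) (3 * n - 1) 2 (3 * n + 1)
      (∅ ∪ (SimpleGraph.cycleGraph (3 * n + 2)).neighborSet p) {p}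
      (by omega) (Or.inl (by omega)) ?_ ?_ ?_ (by omega)
    · refine this.mono ?_
      rw [Finset.card_singleton]
      omega
    · intro v
      have := v.isLt
      rw [Set.empty_union, SimpleGraph.mem_neighborSet, cycle_adj, Finset.mem_singleton,
        Fin.ext_iff, hpv]
      omega
    · intro v hv
      rw [Finset.mem_singleton] at hv
      rw [hv]
      omega
    · intro v hv q hq
      rw [Finset.mem_singleton] at hv
      rw [hv]
      rw [Set.empty_union] at hq
      exact hq
  · have := extVanish_path (k := k) (3 * n + 1) 1 (3 * n + 2) (insert p ∅) ∅
      (by omega) (Or.inl le_rfl) ?_ (by simp) (by simp) le_rfl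
    · refine this.mono ?_
      rw [Finset.card_empty]
      omega
    · intro v
      have := v.isLt
      rw [insert_empty_eq, Set.mem_singleton_iff, Fin.ext_iff, hpv]
      simp only [Finset.notMem_empty, false_or]
      omega

/-- The vertices `0, 3, …, 3 n`, an independent dominating set. -/
def threefold (n : ℕ) : Finset (Fin (3 * n + 2)) := (Finset.range (n + 1)).image (center n)

lemma mem_threefold {v : Fin (3 * n + 2)} : v ∈ threefold n ↔ ∃ j, j ≤ n ∧ v.val = 3 * j := by
  simp only [threefold, Finset.mem_image, Finset.mem_range, Nat.lt_succ_iff]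
  refine exists_congr fun j => and_congr_right fun hj => ?_
  have : (center n j).val = 3 * j := val_idx (by omega)
  rw [Fin.ext_iff, this, eq_comm]

lemma card_threefold_le : (threefold n).card ≤ n + 1 :=
  Finset.card_image_le.trans (Finset.card_range _).le

lemma depth_cycle_le (hn : 1 ≤ n) :
    depth (Ideal.span (Set.range (X : Fin (3 * n + 2) → MvPolynomial (Fin (3 * n + 2)) k)))
      (MvPolynomial (Fin (3 * n + 2)) k ⧸ edgeIdeal k (SimpleGraph.cycleGraph (3 * n + 2)))
      ≤ ((n + 1 : ℕ) : ℕ∞) := by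
  refine (depth_le_card_of_dominating _ (threefold n) ?_ ?_).trans
    (by exact_mod_cast card_threefold_le)
  · intro p hp q hq
    obtain ⟨i, hi, hp⟩ := mem_threefold.1 hp
    obtain ⟨j, hj, hq⟩ := mem_threefold.1 hq
    rw [cycle_adj]
    omega
  · intro v hv
    have hv' : ∀ j, j ≤ n → v.val ≠ 3 * j := fun j hj h => hv (mem_threefold.2 ⟨j, hj, h⟩)
    have hlt := v.isLt
    by_cases hlast : v.val = 3 * n + 1
    · refine ⟨⟨0, by omega⟩, mem_threefold.2 ⟨0, by omega, rfl⟩, ?_⟩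
      rw [cycle_adj]
      right; right; right
      exact ⟨rfl, hlast⟩
    · have hmod := hv' (v.val / 3) (by omega)
      by_cases h1 : v.val % 3 = 1
      · refine ⟨⟨v.val - 1, by omega⟩, mem_threefold.2 ⟨v.val / 3, by omega, ?_⟩, ?_⟩
        · change v.val - 1 = _; omega
        · rw [cycle_adj]
          right; left
          change v.val - 1 + 1 = _; omega
      · refine ⟨⟨v.val + 1, by omega⟩, mem_threefold.2 ⟨v.val / 3 + 1, by omega, ?_⟩, ?_⟩
        · change v.val + 1 = _; omega
        · rw [cycle_adj]
          exact Or.inl rfl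

theorem depth_cycle (hn : 1 ≤ n) :
    depth (Ideal.span (Set.range (X : Fin (3 * n + 2) → MvPolynomial (Fin (3 * n + 2)) k)))
      (MvPolynomial (Fin (3 * n + 2)) k ⧸ edgeIdeal k (SimpleGraph.cycleGraph (3 * n + 2)))
      = ((n + 1 : ℕ) : ℕ∞) := by
  refine le_antisymm (depth_cycle_le hn) ?_
  have hle : edgeIdeal k (SimpleGraph.cycleGraph (3 * n + 2)) ≤ Ideal.span (Set.range X) := by
    rw [edgeIdeal_eq_monomialIdeal]
    exact monomialIdeal_edgeExponents_le _ _
  obtain ⟨rs, hlen, hmem, hreg⟩ :=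
    (extVanish_iff hle span_range_X_ne_top).1 (extVanish_cycle hn)
  rw [← hlen]
  exact le_iSup₂_of_le rs ⟨hmem, hreg⟩ le_rfl

end Cycle

end InitReg

end

theorem theorem3p3 (k : Type*) [Field k] (n : ℕ) (hn : 1 ≤ n) :
    (∃ m : MonomialOrder.{0, 0} (Fin (3 * n + 2)), InitReg.IsAdmissible m) ∧
    (∀ m : MonomialOrder (Fin (3 * n + 2)), InitReg.IsAdmissible m →
      InitReg.IsInitiallyRegular m
        (InitReg.edgeIdeal k (SimpleGraph.cycleGraph (3 * n + 2)))
        (InitReg.cycleForm k n) (n + 1)) ∧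
    InitReg.depth
        (Ideal.span (Set.range
          (MvPolynomial.X : Fin (3 * n + 2) → MvPolynomial (Fin (3 * n + 2)) k)))
        (MvPolynomial (Fin (3 * n + 2)) k ⧸
          InitReg.edgeIdeal k (SimpleGraph.cycleGraph (3 * n + 2))) = ((n + 1 : ℕ) : ℕ∞) :=
  ⟨InitReg.exists_isAdmissible hn, fun m hm => InitReg.isInitiallyRegular_cycleForm hn m hm,
    InitReg.depth_cycle hn⟩
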